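/- Setting. For each sample size $n$ consider the linear model $\mathbf y=\mathbf X\boldsymbol\beta^0+\boldsymbol\epsilon=\sum_{g=1}^{G_n}\mathbf X_g\boldsymbol\beta_g^0+\boldsymbol\epsilon$ with $\boldsymbol\epsilon\sim N(\mathbf 0,\sigma^2I_n)$, where $\sigma^2>0$ is known and fixed, $\mathbf X_g$ is an $n\times m_g$ matrix, $G_n\le n$, the group sizes are bounded ($\sup_n\max_{g\le G_n}m_g<\infty$), and the design is block orthogonal ($\mathbf X_g^{\mathrm T}\mathbf X_h=\mathbf 0$ for $g\ne h$); the model, the design and $\boldsymbol\beta^0$ may all depend on $n$. Let $\mathcal A=\{g:\boldsymbol\beta_g^0\ne\mathbf 0\}$ be the set of active groups. For $\tau_n>0$ use the hierarchical model $\mathbf y\mid\boldsymbol\beta\sim N_n(\mathbf X\boldsymbol\beta,\sigma^2I_n)$ and, independently over $g$, $\boldsymbol\beta_g\mid\lambda_g^2\sim N_{m_g}(\mathbf 0,\lambda_g^2\sigma^2\tau_n^2(\mathbf X_g^{\mathrm T}\mathbf X_g)^{-1})$, $\lambda_g^2\sim\pi$, where $\pi$ is a proper probability density on $(0,\infty)$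 with $\pi(t)\propto t^{-a-1}L(t)$, $a>0$, and $L:(0,\infty)\to(0,\infty)$ is measurable, non-constant and slowly varying at infinity. Assume that $a\ge\frac12$, that $L(t)\ge c_0>0$ for all $t\ge t_0$, for some $c_0,t_0>0$, and that $\sup_{t>0}L(t)<\infty$. Put $\kappa_g=1/(1+\lambda_g^2\tau_n^2)$. The half-thresholding estimator $\widehat{\boldsymbol\beta}_g^{\mathrm{HT}}$ is the posterior mean $E(\boldsymbol\beta_g\mid\tau_n,\sigma^2,\mathbf y)$ if $E(1-\kappa_g\mid\tau_n,\sigma^2,\mathbf y)>\frac12$, and $\mathbf 0$ otherwise. Theorem. Assume in addition that, for constants that do not depend on $n$: (C1) there are $0<C_1\le C_2<\infty$ such that all eigenvalues of $\frac1n\mathbf X^{\mathrm T}\mathbf X$ lie in $[C_1,C_2]$; (C2) there is $C_3>0$ with $\min_j|\beta^0_{gj}|>C_3$ for all $g\in\mathcal A$; (C3) $\tau_n\to0$, $G_n\sqrt{\tau_n}\log(1/\tau_n)\to\infty$ and $\sqrt{\tau_n}\log(1/\tau_n)=o(1/|\mathcal A|)$ as $n\to\infty$. Let $\mathbf X_{\mathcal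 A}$ consist of the columns of $\mathbf X$ in active groups, $\boldsymbol\Sigma_{\mathcal A}=\mathbf X_{\mathcal A}^{\mathrm T}\mathbf X_{\mathcal A}$, and let $\boldsymbol\Sigma_{\mathcal A}^{1/2}$ be its positive semidefinite square root. Then for any vectors $\boldsymbol\alpha=\boldsymbol\alpha_n$ of the dimension of $\boldsymbol\beta^0_{\mathcal A}$ with $\|\boldsymbol\alpha\|_2=1$, $$\boldsymbol\alpha^{\mathrm T}\boldsymbol\Sigma_{\mathcal A}^{1/2}\bigl(\widehat{\boldsymbol\beta}^{\mathrm{HT}}_{\mathcal A}-\boldsymbol\beta^0_{\mathcal A}\bigr)\xrightarrow{d}N(0,\sigma^2)\qquad(n\to\infty).$$ That is, the half-thresholding estimator attains the optimal estimation rate. -/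

import Mathlib

open MeasureTheory ProbabilityTheory Filter Topology Matrix
open scoped MatrixOrder

noncomputable section

namespace GroupHT

/-- `L : (0,∞) → (0,∞)` is slowly varying at infinity in Karamata's sense. -/
def SlowlyVarying (L : ℝ → ℝ) : Prop :=
  ∀ c : ℝ, 0 < c → Tendsto (fun x => L (c * x) / L x) atTop (𝓝 1)

/-- The class of priors `π(t) ∝ t ^ (-a-1) L(t)` on `(0,∞)`: `a > 0`, and `L` is measurable,
positive, non-constant and slowly varying on `(0,∞)`; the prior is a proper probability density,
that is, `t ^ (-a-1) L(t)` has a finite integral. -/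
structure PolynomialTailPrior (a : ℝ) (L : ℝ → ℝ) : Prop where
  a_pos : 0 < a
  measurable : Measurable L
  pos : ∀ t, 0 < t → 0 < L t
  nonconst : ∃ s t, 0 < s ∧ 0 < t ∧ L s ≠ L t
  slowlyVarying : SlowlyVarying L
  proper : IntegrableOn (fun t => t ^ (-a - 1) * L t) (Set.Ioi 0)

/-- `a ≥ 1/2`, and `L` is bounded above on `(0,∞)` and bounded away from `0` near infinity. -/
structure TailAssumption (a : ℝ) (L : ℝ → ℝ) : Prop where
  half_le : 1 / 2 ≤ a
  lower : ∃ c₀ t₀ : ℝ, 0 < c₀ ∧ 0 < t₀ ∧ ∀ t, t₀ ≤ t → c₀ ≤ L t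
  upper : ∃ M : ℝ, 0 < M ∧ ∀ t, 0 < t → L t ≤ M

/-- Prior density of a squared local shrinkage parameter `λ²`. -/
def localPriorDensity (a : ℝ) (L : ℝ → ℝ) (t : ℝ) : ℝ :=
  if 0 < t then t ^ (-a - 1) * L t / ∫ s in Set.Ioi 0, s ^ (-a - 1) * L s else 0

/-- Lebesgue density of the centred normal distribution with covariance matrix `S`
(for `S` positive definite). -/
def gaussianDensity {k : ℕ} (S : Matrix (Fin k) (Fin k) ℝ) (x : Fin k → ℝ) : ℝ :=
  Real.exp (-(x ⬝ᵥ (S⁻¹ *ᵥ x)) / 2) / √((2 * Real.pi) ^ k * S.det)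

/-- The columns of the design matrix that belong to group `g`. -/
def block {n G : ℕ} {m : Fin G → ℕ} (X : Matrix (Fin n) (Σ g, Fin (m g)) ℝ) (g : Fin G) :
    Matrix (Fin n) (Fin (m g)) ℝ :=
  X.submatrix id (fun j => ⟨g, j⟩)

/-- `X_gᵀ X_h = 0` for distinct groups `g`, `h`. -/
def BlockOrthogonal {n G : ℕ} {m : Fin G → ℕ} (X : Matrix (Fin n) (Σ g, Fin (m g)) ℝ) : Prop :=
  ∀ g h, g ≠ h → (block X g)ᵀ * block X h = 0

/-- The linear predictor `X β = ∑ g, X_g β_g`. -/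
def linPred {n G : ℕ} {m : Fin G → ℕ} (X : Matrix (Fin n) (Σ g, Fin (m g)) ℝ)
    (β : ∀ g, Fin (m g) → ℝ) : Fin n → ℝ :=
  ∑ g, block X g *ᵥ β g

/-- Parameter space: `θ g = (λ_g², β_g)`. -/
abbrev Param {G : ℕ} (m : Fin G → ℕ) : Type := ∀ g : Fin G, ℝ × (Fin (m g) → ℝ)

/-- Joint density, in `(y, λ², β)`, of the hierarchical model with known `σ` and `τ`:
`y | β ~ N(Xβ, σ² I)`, and independently over `g`, `λ_g² ~ π` and
`β_g | λ_g² ~ N(0, λ_g² σ² τ² (X_gᵀ X_g)⁻¹)`. -/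
def jointDensity {n G : ℕ} {m : Fin G → ℕ} (X : Matrix (Fin n) (Σ g, Fin (m g)) ℝ)
    (σ a : ℝ) (L : ℝ → ℝ) (τ : ℝ) (y : Fin n → ℝ) (θ : Param m) : ℝ :=
  gaussianDensity (σ ^ 2 • (1 : Matrix (Fin n) (Fin n) ℝ)) (y - linPred X (fun g => (θ g).2)) *
    ∏ g, localPriorDensity a L (θ g).1 *
      gaussianDensity (((θ g).1 * σ ^ 2 * τ ^ 2) • ((block X g)ᵀ * block X g)⁻¹) (θ g).2

/-- Posterior expectation `E(f(λ², β) | τ, σ², y)`, by Bayes' formula. -/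
def posteriorExp {n G : ℕ} {m : Fin G → ℕ} (X : Matrix (Fin n) (Σ g, Fin (m g)) ℝ)
    (σ a : ℝ) (L : ℝ → ℝ) (τ : ℝ) (y : Fin n → ℝ) (f : Param m → ℝ) : ℝ :=
  (∫ θ, f θ * jointDensity X σ a L τ y θ) / ∫ θ, jointDensity X σ a L τ y θ

/-- The shrinkage coefficient `κ = 1 / (1 + λ² τ²)` as a function of `t = λ²`. -/
def kappa (τ t : ℝ) : ℝ := 1 / (1 + t * τ ^ 2)

/-- `E(1 - κ_g | τ, σ², y)`. -/
def shrinkWeight {n G : ℕ} {m : Fin G → ℕ} (X : Matrix (Fin n) (Σ g, Fin (m g)) ℝ)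
    (σ a : ℝ) (L : ℝ → ℝ) (τ : ℝ) (y : Fin n → ℝ) (g : Fin G) : ℝ :=
  posteriorExp X σ a L τ y (fun θ => 1 - kappa τ (θ g).1)

/-- The posterior mean of `β_g`. -/
def posteriorMean {n G : ℕ} {m : Fin G → ℕ} (X : Matrix (Fin n) (Σ g, Fin (m g)) ℝ)
    (σ a : ℝ) (L : ℝ → ℝ) (τ : ℝ) (y : Fin n → ℝ) (g : Fin G) : Fin (m g) → ℝ :=
  fun j => posteriorExp X σ a L τ y (fun θ => (θ g).2 j)

open Classical in
/-- The half-thresholding estimator of `β_g`: the posterior mean if `E(1 - κ_g | τ, σ², y) > 1/2`,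
and `0` otherwise. -/
def htEstimator {n G : ℕ} {m : Fin G → ℕ} (X : Matrix (Fin n) (Σ g, Fin (m g)) ℝ)
    (σ a : ℝ) (L : ℝ → ℝ) (τ : ℝ) (y : Fin n → ℝ) (g : Fin G) : Fin (m g) → ℝ :=
  if 1 / 2 < shrinkWeight X σ a L τ y g then posteriorMean X σ a L τ y g else 0

open Classical in
/-- The set of active groups, `{g | β_g ≠ 0}`. -/
def active {G : ℕ} {m : Fin G → ℕ} (β : ∀ g, Fin (m g) → ℝ) : Finset (Fin G) :=
  Finset.univ.filter (fun g => β g ≠ 0)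

/-- Indices of the individual variables in active groups. -/
abbrev ActiveIdx {G : ℕ} {m : Fin G → ℕ} (β : ∀ g, Fin (m g) → ℝ) : Type :=
  Σ g : {g // g ∈ active β}, Fin (m g.1)

/-- `X_A`, the columns of the design matrix in active groups. -/
def activeDesign {n G : ℕ} {m : Fin G → ℕ} (X : Matrix (Fin n) (Σ g, Fin (m g)) ℝ)
    (β : ∀ g, Fin (m g) → ℝ) : Matrix (Fin n) (ActiveIdx β) ℝ :=
  X.submatrix id (fun k => ⟨k.1.1, k.2⟩)

/-- `Σ_A = X_Aᵀ X_A`. -/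
def activeGram {n G : ℕ} {m : Fin G → ℕ} (X : Matrix (Fin n) (Σ g, Fin (m g)) ℝ)
    (β : ∀ g, Fin (m g) → ℝ) : Matrix (ActiveIdx β) (ActiveIdx β) ℝ :=
  (activeDesign X β)ᵀ * activeDesign X β

/-- `αᵀ Σ_A^{1/2} (b_A - β_A)`, the square root being the positive semidefinite one. -/
def activeStatistic {n G : ℕ} {m : Fin G → ℕ} (X : Matrix (Fin n) (Σ g, Fin (m g)) ℝ)
    (β : ∀ g, Fin (m g) → ℝ) (α : EuclideanSpace ℝ (ActiveIdx β))
    (b : ∀ g, Fin (m g) → ℝ) : ℝ :=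
  α.ofLp ⬝ᵥ (CFC.sqrt (activeGram X β) *ᵥ fun k => b k.1.1 k.2 - β k.1.1 k.2)

end GroupHT

end

open GroupHT

/-!
Under block orthogonality the likelihood is a product over the groups
(`exists_jointDensity_eq`), so the posterior of a group is computed within the group. Completing
the square and scaling the Gaussian integral shows that the posterior mean of a group is its least
squares estimate times `1 - E κ`, where `E κ = meanKappa` depends on the data through the signal
`S = ‖X_g w_g‖² / σ²` of the least squares estimate `w_g` only (`shrinkWeight_eq`,
`posteriorMean_eq`). A group set to `0` has `E κ ≥ 1/2`; hence thresholding at most doubles the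
shrinkage (`exists_htEstimator_eq`).

For large signals `E κ = O(1/S)` (`exists_meanKappa_le`). The polynomial tail of the prior makes
the denominator of `E κ` of the order `S ^ (-k/2) (S/τ²) ^ (-a)`; the numerator has an extra factor
`1/S`, apart from the contribution `exp (-S/4)` of small `λ²`. The latter is negligible because
`1/τ²` is at most a power of `n`, a consequence of `G √τ log (1/τ) → ∞` and `G ≤ n`, whereas `S` is
of the order `n`.

With `Σ_A` the Gram matrix of the active columns, the least squares error `d` satisfies
`Σ_A^{1/2} d = Uᵀ ε` for a matrix `U` with orthonormal columns
(`exists_orthonormal_sqrt_mulVec`). The least squares version of the statistic is therefore exactly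
`N(0, σ²)`. The second moment of `Uᵀ ε` is `σ²` times the number of active variables, which is
`o(n)`, so that with probability tending to one every active group has a signal of the order
`n`. By Cauchy–Schwarz, shrinkage then changes the statistic by at most the square root of
`∑_{g ∈ A} (2 E κ_g)² σ² S_g = O(|A| / n) → 0` (`exists_sq_activeStatistic_sub_le`), and the claim
follows as in Slutsky's theorem (`tendstoInDistribution_of_abs_sub_le`).
-/

namespace GroupHT

/-! ### The prior on the squared local shrinkage parameters -/

section Prior

variable {a : ℝ} {L : ℝ → ℝ}

/-- The integral of `t ^ (-a-1) L(t)` over `(0,∞)`, by which the prior density is normalised. -/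
noncomputable def priorMass (a : ℝ) (L : ℝ → ℝ) : ℝ := ∫ s in Set.Ioi 0, s ^ (-a - 1) * L s

lemma priorMass_pos (h : PolynomialTailPrior a L) : 0 < priorMass a L := by
  have hpos : ∀ t ∈ Set.Ioi (0 : ℝ), 0 < t ^ (-a - 1) * L t := fun t ht =>
    mul_pos (Real.rpow_pos_of_pos ht _) (h.pos t ht)
  rw [priorMass, setIntegral_pos_iff_support_of_nonneg_ae _ h.proper]
  · have : Function.support (fun t => t ^ (-a - 1) * L t) ∩ Set.Ioi (0 : ℝ) = Set.Ioi 0 :=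
      Set.inter_eq_right.2 fun t ht => (hpos t ht).ne'
    rw [this]
    simp
  · filter_upwards [self_mem_ae_restrict measurableSet_Ioi] with t ht using (hpos t ht).le

lemma localPriorDensity_eq_indicator :
    localPriorDensity a L =
      (Set.Ioi 0).indicator fun t => t ^ (-a - 1) * L t / priorMass a L := by
  ext t
  simp [localPriorDensity, Set.indicator_apply, priorMass]

lemma localPriorDensity_of_pos {t : ℝ} (ht : 0 < t) :
    localPriorDensity a L t = t ^ (-a - 1) * L t / priorMass a L := by
  simp [localPriorDensity, ht, priorMass]

lemma localPriorDensity_of_nonpos {t : ℝ} (ht : t ≤ 0) : localPriorDensity a L t = 0 := by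
  simp [localPriorDensity, ht.not_gt]

lemma localPriorDensity_pos (h : PolynomialTailPrior a L) {t : ℝ} (ht : 0 < t) :
    0 < localPriorDensity a L t := by
  rw [localPriorDensity_of_pos ht]
  exact div_pos (mul_pos (Real.rpow_pos_of_pos ht _) (h.pos t ht)) (priorMass_pos h)

lemma localPriorDensity_nonneg (h : PolynomialTailPrior a L) (t : ℝ) :
    0 ≤ localPriorDensity a L t := by
  rcases le_or_gt t 0 with ht | ht
  · rw [localPriorDensity_of_nonpos ht]
  · exact (localPriorDensity_pos h ht).le

lemma measurable_localPriorDensity (h : PolynomialTailPrior a L) :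
    Measurable (localPriorDensity a L) := by
  rw [localPriorDensity_eq_indicator]
  have := h.measurable
  exact Measurable.indicator (by fun_prop) measurableSet_Ioi

lemma integrable_localPriorDensity (h : PolynomialTailPrior a L) :
    Integrable (localPriorDensity a L) := by
  rw [localPriorDensity_eq_indicator, integrable_indicator_iff measurableSet_Ioi]
  exact h.proper.div_const _

lemma integral_localPriorDensity (h : PolynomialTailPrior a L) :
    ∫ t, localPriorDensity a L t = 1 := by
  rw [localPriorDensity_eq_indicator, integral_indicator measurableSet_Ioi, integral_div]
  exact div_self (priorMass_pos h).ne'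

end Prior

section Kappa

variable {τ t : ℝ}

lemma kappa_pos (ht : 0 ≤ t) : 0 < kappa τ t := by unfold kappa; positivity

lemma kappa_le_one (ht : 0 ≤ t) : kappa τ t ≤ 1 := by
  unfold kappa
  rw [div_le_one (by positivity)]
  nlinarith [mul_nonneg ht (sq_nonneg τ)]

lemma measurable_kappa (τ : ℝ) : Measurable (kappa τ) := by
  unfold kappa
  fun_prop

end Kappa

/-! ### Posterior moments of the shrinkage coefficient -/

/-- The unnormalised posterior density of `λ²` at `t`, weighted by a power of `κ`:
`π(t) κ ^ p exp (-κ S / 2)`. For a group of size `k` the posterior density is the case `p = k / 2`,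
with `S` the squared norm of the fitted group, in units of `σ²`. -/
noncomputable def shrinkKernel (a : ℝ) (L : ℝ → ℝ) (τ S p t : ℝ) : ℝ :=
  localPriorDensity a L t * (kappa τ t ^ p * Real.exp (-(kappa τ t * S) / 2))

/-- The posterior expectation of `κ` in a group of size `k` as a function of `S`. -/
noncomputable def meanKappa (a : ℝ) (L : ℝ → ℝ) (τ : ℝ) (k : ℕ) (S : ℝ) : ℝ :=
  (∫ t, shrinkKernel a L τ S (k / 2 + 1) t) / ∫ t, shrinkKernel a L τ S (k / 2) t

section Moments

variable {a : ℝ} {L : ℝ → ℝ} {τ S p : ℝ}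

lemma shrinkKernel_nonneg (h : PolynomialTailPrior a L) (t : ℝ) :
    0 ≤ shrinkKernel a L τ S p t := by
  rcases le_or_gt t 0 with ht | ht
  · simp [shrinkKernel, localPriorDensity_of_nonpos ht]
  · have := kappa_pos (τ := τ) ht.le
    have := localPriorDensity_nonneg h t
    unfold shrinkKernel
    positivity

lemma shrinkKernel_le (h : PolynomialTailPrior a L) (hS : 0 ≤ S) (hp : 0 ≤ p) (t : ℝ) :
    shrinkKernel a L τ S p t ≤ localPriorDensity a L t := by
  rcases le_or_gt t 0 with ht | ht
  · simp [shrinkKernel, localPriorDensity_of_nonpos ht]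
  · have hκ := kappa_pos (τ := τ) ht.le
    refine mul_le_of_le_one_right (localPriorDensity_nonneg h t) ?_
    refine mul_le_one₀ (Real.rpow_le_one hκ.le (kappa_le_one ht.le) hp) (Real.exp_pos _).le ?_
    rw [Real.exp_le_one_iff]
    have := mul_nonneg hκ.le hS
    linarith

lemma measurable_shrinkKernel (h : PolynomialTailPrior a L) :
    Measurable (shrinkKernel a L τ S p) := by
  have h1 := measurable_localPriorDensity h
  have h2 := measurable_kappa τ
  unfold shrinkKernel
  fun_prop

lemma integrable_shrinkKernel (h : PolynomialTailPrior a L) (hS : 0 ≤ S) (hp : 0 ≤ p) :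
    Integrable (shrinkKernel a L τ S p) := by
  refine (integrable_localPriorDensity h).mono'
    (measurable_shrinkKernel h).aestronglyMeasurable (ae_of_all _ fun t => ?_)
  rw [Real.norm_of_nonneg (shrinkKernel_nonneg h t)]
  exact shrinkKernel_le h hS hp t

lemma integral_shrinkKernel_pos (h : PolynomialTailPrior a L) (hS : 0 ≤ S) (hp : 0 ≤ p) :
    0 < ∫ t, shrinkKernel a L τ S p t := by
  rw [integral_pos_iff_support_of_nonneg (shrinkKernel_nonneg h)
    (integrable_shrinkKernel h hS hp)]
  have : Set.Ioi (0 : ℝ) ⊆ Function.support (shrinkKernel a L τ S p) := fun t ht => by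
    have h1 := kappa_pos (τ := τ) (le_of_lt ht)
    have h2 := localPriorDensity_pos h ht
    have : 0 < shrinkKernel a L τ S p t := by unfold shrinkKernel; positivity
    exact this.ne'
  exact lt_of_lt_of_le (by simp) (measure_mono this)

lemma meanKappa_nonneg (h : PolynomialTailPrior a L) (τ : ℝ) (k : ℕ) (S : ℝ) :
    0 ≤ meanKappa a L τ k S :=
  div_nonneg (integral_nonneg fun _ => shrinkKernel_nonneg h _)
    (integral_nonneg fun _ => shrinkKernel_nonneg h _)

/-- From `1 + u ≤ exp u` at `u = x / (2q)`. -/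
lemma rpow_mul_exp_neg_half_le {q x : ℝ} (hq : 0 < q) (hx : 0 ≤ x) :
    x ^ q * Real.exp (-x / 2) ≤ (2 * q) ^ q := by
  have h1 : x ≤ (2 * q) * Real.exp (x / (2 * q)) := by
    have := Real.add_one_le_exp (x / (2 * q))
    calc x = 2 * q * (x / (2 * q)) := by field_simp
      _ ≤ _ := by gcongr; linarith
  have h2 : x ^ q ≤ (2 * q) ^ q * Real.exp (x / 2) := by
    calc x ^ q ≤ ((2 * q) * Real.exp (x / (2 * q))) ^ q := by gcongr
      _ = _ := by
        rw [Real.mul_rpow (by positivity) (Real.exp_pos _).le, ← Real.exp_mul]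
        congr 2
        field_simp
  calc x ^ q * Real.exp (-x / 2) ≤ (2 * q) ^ q * Real.exp (x / 2) * Real.exp (-x / 2) := by gcongr
    _ = (2 * q) ^ q := by rw [mul_assoc, ← Real.exp_add]; ring_nf; simp

/-- Lower bound on a posterior moment. On `[S/τ², 2S/τ²]` the coefficient `κ` is of the order
`1/S`, so that the exponential factor is bounded below and the polynomial tail of the prior gives
the mass. -/
lemma exists_le_integral_shrinkKernel (h : PolynomialTailPrior a L) {c₀ t₀ : ℝ} (hc₀ : 0 < c₀)
    (hL : ∀ t, t₀ ≤ t → c₀ ≤ L t) (hp : 0 ≤ p) :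
    ∃ c : ℝ, 0 < c ∧ ∀ τ S : ℝ, 0 < τ → 1 ≤ S → t₀ ≤ S / τ ^ 2 →
      c * (S ^ (-p) * (S / τ ^ 2) ^ (-a)) ≤ ∫ t, shrinkKernel a L τ S p t := by
  have hZ := priorMass_pos h
  refine ⟨c₀ / priorMass a L * 2 ^ (-a - 1) * 3 ^ (-p) * Real.exp (-1 / 2), by positivity, ?_⟩
  intro τ S hτ hS ht₀
  have hS0 : 0 < S := by linarith
  have ha := h.a_pos
  set V := S / τ ^ 2 with hV
  have hVpos : 0 < V := by positivity
  have hVτ : V * τ ^ 2 = S := by rw [hV]; field_simp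
  have hint := integrable_shrinkKernel (τ := τ) h hS0.le hp
  have key : ∀ t ∈ Set.Icc V (2 * V),
      (2 * V) ^ (-a - 1) * c₀ / priorMass a L * ((3 * S) ^ (-p) * Real.exp (-1 / 2)) ≤
        shrinkKernel a L τ S p t := by
    rintro t ⟨h1, h2⟩
    have ht : 0 < t := by linarith
    have hτ2 : 0 < τ ^ 2 := by positivity
    have h3 : S ≤ t * τ ^ 2 := by rw [← hVτ]; gcongr
    have h4 : t * τ ^ 2 ≤ 2 * S := by rw [← hVτ, ← mul_assoc]; gcongr
    have hκ1 : (3 * S)⁻¹ ≤ kappa τ t := by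
      rw [kappa, one_div]
      gcongr
      linarith
    have hκ2 : kappa τ t * S ≤ 1 := by
      rw [kappa, one_div, inv_mul_le_iff₀ (by positivity)]
      linarith
    rw [shrinkKernel, localPriorDensity_of_pos ht]
    have hL' := hL t (by linarith)
    have e1 : (2 * V) ^ (-a - 1) ≤ t ^ (-a - 1) :=
      Real.rpow_le_rpow_of_nonpos ht h2 (by linarith)
    have e2 : (3 * S) ^ (-p) ≤ kappa τ t ^ p := by
      rw [Real.rpow_neg (by positivity), ← Real.inv_rpow (by positivity)]
      gcongr
    have e3 : Real.exp (-1 / 2) ≤ Real.exp (-(kappa τ t * S) / 2) := by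
      gcongr
    have hLt := h.pos t ht
    have hκ0 := kappa_pos (τ := τ) ht.le
    gcongr
  calc _ = (2 * V) ^ (-a - 1) * c₀ / priorMass a L * ((3 * S) ^ (-p) * Real.exp (-1 / 2)) * V := by
        rw [Real.mul_rpow (by norm_num) hVpos.le, Real.mul_rpow (by norm_num) hS0.le,
          show -a - 1 = -a + -1 by ring, Real.rpow_add hVpos, Real.rpow_neg_one]
        field_simp
    _ = (2 * V) ^ (-a - 1) * c₀ / priorMass a L * ((3 * S) ^ (-p) * Real.exp (-1 / 2)) *
          volume.real (Set.Icc V (2 * V)) := by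
        rw [Real.volume_real_Icc_of_le (by linarith)]; ring
    _ ≤ ∫ t in Set.Icc V (2 * V), shrinkKernel a L τ S p t :=
        setIntegral_ge_of_const_le_real measurableSet_Icc (by simp) key hint.integrableOn
    _ ≤ _ := setIntegral_le_integral hint (ae_of_all _ fun t => shrinkKernel_nonneg h t)

/-- Upper bound on a posterior moment. Where `κ ≥ 1/2` the exponential factor is at most
`exp (-S/4)`; for `1/τ² ≤ t ≤ S/τ²` it compensates powers of `κ`; beyond `S/τ²` the coefficient
`κ` is at most `1/S` and the tail of the prior is integrated. -/
lemma exists_integral_shrinkKernel_le (h : PolynomialTailPrior a L) {M : ℝ} (hM : 0 < M)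
    (hL : ∀ t, 0 < t → L t ≤ M) (hp : 0 ≤ p) :
    ∃ C : ℝ, 0 < C ∧ ∀ τ S : ℝ, 0 < τ → 1 ≤ S →
      ∫ t, shrinkKernel a L τ S p t ≤
        Real.exp (-S / 4) + C * (S ^ (-p) * (S / τ ^ 2) ^ (-a)) := by
  have hZ := priorMass_pos h
  have ha := h.a_pos
  set q := p + a + 1 with hq
  have hq0 : 0 < q := by positivity
  set D := M / priorMass a L with hD
  have hD0 : 0 < D := by positivity
  refine ⟨D * 2 ^ (a + 1) * (2 * q) ^ q + D / a, by positivity, ?_⟩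
  intro τ S hτ hS
  have hS0 : 0 < S := by linarith
  set V := S / τ ^ 2 with hV
  have hVpos : 0 < V := by positivity
  have hτ2 : 0 < τ ^ 2 := by positivity
  have hVτ : V * τ ^ 2 = S := by rw [hV]; field_simp
  set c₁ := D * 2 ^ (a + 1) * (2 * q) ^ q * (S ^ (-p) * V ^ (-a - 1)) with hc₁
  have hc₁0 : 0 ≤ c₁ := by positivity
  have hint := integrable_shrinkKernel (τ := τ) h hS0.le hp
  have hprior : ∀ t, 0 < t → localPriorDensity a L t ≤ D * t ^ (-a - 1) := fun t ht => by
    rw [localPriorDensity_of_pos ht, hD, mul_div_assoc, mul_comm]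
    have := hL t ht
    gcongr
  have key : ∀ t, shrinkKernel a L τ S p t ≤ Real.exp (-S / 4) * localPriorDensity a L t +
      (Set.Ioc 0 V).indicator (fun _ => c₁) t +
      (Set.Ioi V).indicator (fun t => D * S ^ (-p) * t ^ (-a - 1)) t := by
    intro t
    have hn1 : 0 ≤ (Set.Ioc 0 V).indicator (fun _ => c₁) t :=
      Set.indicator_nonneg (fun _ _ => hc₁0) t
    have hn2 : 0 ≤ (Set.Ioi V).indicator (fun t => D * S ^ (-p) * t ^ (-a - 1)) t :=
      Set.indicator_nonneg (fun t ht => by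
        have : 0 < t := hVpos.trans ht
        positivity) t
    have hn3 : 0 ≤ Real.exp (-S / 4) * localPriorDensity a L t :=
      mul_nonneg (Real.exp_pos _).le (localPriorDensity_nonneg h t)
    rcases le_or_gt t 0 with ht | ht
    · have : shrinkKernel a L τ S p t = 0 := by
        simp [shrinkKernel, localPriorDensity_of_nonpos ht]
      linarith
    have hκ0 := kappa_pos (τ := τ) ht.le
    have hκ1 := kappa_le_one (τ := τ) ht.le
    -- the three ranges `t ≤ 1/τ²`, `1/τ² < t ≤ V` and `V < t`, where `V = S/τ²`
    rcases le_or_gt (t * τ ^ 2) 1 with h1 | h1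
    · have : shrinkKernel a L τ S p t ≤ Real.exp (-S / 4) * localPriorDensity a L t := by
        rw [shrinkKernel, mul_comm]
        have := localPriorDensity_nonneg h t
        gcongr
        have hhalf : 1 / 2 ≤ kappa τ t := by
          rw [kappa]
          gcongr
          linarith
        calc kappa τ t ^ p * Real.exp (-(kappa τ t * S) / 2)
            ≤ 1 * Real.exp (-(kappa τ t * S) / 2) := by
              gcongr
              exact Real.rpow_le_one hκ0.le hκ1 hp
          _ ≤ Real.exp (-S / 4) := by
              rw [one_mul, Real.exp_le_exp]
              nlinarith
      linarith
    rcases le_or_gt t V with h2 | h2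
    · rw [Set.indicator_of_mem (show t ∈ Set.Ioc 0 V from ⟨ht, h2⟩)]
      have : shrinkKernel a L τ S p t ≤ c₁ := by
        have hle : t⁻¹ ≤ 2 * τ ^ 2 * kappa τ t := by
          rw [kappa, mul_one_div, inv_eq_one_div, div_le_div_iff₀ ht (by positivity)]
          nlinarith
        -- the power of `t` is traded for the same power of `κ`, which the exponential absorbs
        have e1 : t ^ (-a - 1) ≤ (2 * τ ^ 2) ^ (a + 1) * kappa τ t ^ (a + 1) := by
          rw [show -a - 1 = -(a + 1) by ring, Real.rpow_neg ht.le, ← Real.inv_rpow ht.le,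
            ← Real.mul_rpow (by positivity) hκ0.le]
          gcongr
        have e2 : (kappa τ t * S) ^ q * Real.exp (-(kappa τ t * S) / 2) ≤ (2 * q) ^ q :=
          rpow_mul_exp_neg_half_le hq0 (by positivity)
        have e3 : kappa τ t ^ q * Real.exp (-(kappa τ t * S) / 2) ≤ S ^ (-q) * (2 * q) ^ q := by
          rw [Real.rpow_neg hS0.le, le_inv_mul_iff₀ (by positivity)]
          rw [Real.mul_rpow hκ0.le hS0.le] at e2
          linarith
        calc shrinkKernel a L τ S p t
            ≤ D * ((2 * τ ^ 2) ^ (a + 1) * kappa τ t ^ (a + 1)) *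
              (kappa τ t ^ p * Real.exp (-(kappa τ t * S) / 2)) := by
              rw [shrinkKernel]
              have := hprior t ht
              gcongr
              exact this.trans (by gcongr)
          _ = D * (2 * τ ^ 2) ^ (a + 1) *
              (kappa τ t ^ q * Real.exp (-(kappa τ t * S) / 2)) := by
              rw [hq, show p + a + 1 = (a + 1) + p by ring, Real.rpow_add hκ0 (a + 1) p]
              ring
          _ ≤ D * (2 * τ ^ 2) ^ (a + 1) * (S ^ (-q) * (2 * q) ^ q) := by gcongr
          _ = c₁ := by
              rw [hc₁, hq, show -(p + a + 1) = -p + -(a + 1) by ring, Real.rpow_add hS0,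
                show -a - 1 = -(a + 1) by ring, hV, Real.div_rpow hS0.le hτ2.le,
                Real.mul_rpow (by norm_num) hτ2.le, Real.rpow_neg hτ2.le]
              field_simp
      linarith
    · rw [Set.indicator_of_mem (show t ∈ Set.Ioi V from h2)]
      have : shrinkKernel a L τ S p t ≤ D * S ^ (-p) * t ^ (-a - 1) := by
        have hκS : kappa τ t ≤ S⁻¹ := by
          rw [kappa, one_div]
          gcongr
          rw [← hVτ]
          nlinarith
        have e1 : kappa τ t ^ p ≤ S ^ (-p) := by
          rw [Real.rpow_neg hS0.le, ← Real.inv_rpow hS0.le]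
          gcongr
        have e2 : Real.exp (-(kappa τ t * S) / 2) ≤ 1 := by
          rw [Real.exp_le_one_iff]
          have := mul_nonneg hκ0.le hS0.le
          linarith
        calc shrinkKernel a L τ S p t ≤ D * t ^ (-a - 1) * (S ^ (-p) * 1) := by
              rw [shrinkKernel]
              have := hprior t ht
              gcongr
          _ = _ := by ring
      linarith
  have hi1 : Integrable fun t => Real.exp (-S / 4) * localPriorDensity a L t :=
    (integrable_localPriorDensity h).const_mul _
  have hi2 : Integrable ((Set.Ioc 0 V).indicator fun _ : ℝ => c₁) :=
    (integrable_indicator_iff measurableSet_Ioc).2 (by simp)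
  have hi3 : Integrable ((Set.Ioi V).indicator fun t : ℝ => D * S ^ (-p) * t ^ (-a - 1)) :=
    (integrable_indicator_iff measurableSet_Ioi).2
      ((integrableOn_Ioi_rpow_of_lt (by linarith) hVpos).const_mul _)
  calc ∫ t, shrinkKernel a L τ S p t ≤ _ := integral_mono hint ((hi1.add hi2).add hi3) key
    _ = Real.exp (-S / 4) + c₁ * V + D * S ^ (-p) * (V ^ (-a) / a) := by
        have e1 := integral_add (hi1.add hi2) hi3
        have e2 := integral_add hi1 hi2
        simp only [Pi.add_apply] at e1 e2 ⊢
        rw [e1, e2, integral_const_mul, integral_localPriorDensity h,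
          integral_indicator measurableSet_Ioc, integral_indicator measurableSet_Ioi,
          setIntegral_const, Real.volume_real_Ioc_of_le hVpos.le, smul_eq_mul,
          integral_const_mul, integral_Ioi_rpow_of_lt (by linarith) hVpos,
          show -a - 1 + 1 = -a by ring, neg_div_neg_eq]
        ring
    _ = _ := by
        rw [hc₁, show -a - 1 = -a + -1 by ring, Real.rpow_add hVpos, Real.rpow_neg_one]
        field_simp
        ring

/-- If the signal `S` is at least a fixed power of `1/τ`, up to a constant, then the posterior
expectation of `κ` is `O(1/S)`. -/
lemma exists_meanKappa_le (h : PolynomialTailPrior a L) (ht : TailAssumption a L) (k : ℕ)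
    {D : ℝ} (hD : 0 < D) :
    ∃ C τ₀ : ℝ, 0 < C ∧ 0 < τ₀ ∧ ∀ τ S : ℝ, 0 < τ → τ ≤ τ₀ → 1 ≤ S → 1 / τ ^ 2 ≤ D * S ^ 8 →
      meanKappa a L τ k S ≤ C / S := by
  obtain ⟨c₀, t₀, hc₀, ht₀, hlow⟩ := ht.lower
  obtain ⟨M, hM, hup⟩ := ht.upper
  have ha := h.a_pos
  obtain ⟨c, hc, hden⟩ := exists_le_integral_shrinkKernel (p := (k : ℝ) / 2) h hc₀ hlow
    (by positivity)
  obtain ⟨C, hC, hnum⟩ := exists_integral_shrinkKernel_le (p := (k : ℝ) / 2 + 1) h hM hup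
    (by positivity)
  set p : ℝ := (k : ℝ) / 2 with hp
  have hp0 : 0 ≤ p := by positivity
  set q : ℝ := p + 9 * a + 1 with hq
  have hq0 : 0 < q := by positivity
  refine ⟨(D ^ a * (2 ^ q * (2 * q) ^ q) + C) / c, (√t₀)⁻¹, by positivity, by positivity, ?_⟩
  intro τ S hτ hττ hS hτS
  have hS0 : 0 < S := by linarith
  have hτ2 : 0 < τ ^ 2 := by positivity
  set V := S / τ ^ 2 with hV
  have hVpos : 0 < V := by positivity
  have ht₀V : t₀ ≤ V := by
    rw [hV, le_div_iff₀ hτ2]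
    have : τ ^ 2 ≤ ((√t₀)⁻¹) ^ 2 := by gcongr
    rw [inv_pow, Real.sq_sqrt ht₀.le] at this
    calc t₀ * τ ^ 2 ≤ t₀ * t₀⁻¹ := by gcongr
      _ = 1 := mul_inv_cancel₀ ht₀.ne'
      _ ≤ S := hS
  have hd := hden τ S hτ hS ht₀V
  have hn := hnum τ S hτ hS
  have hVle : V ^ a ≤ D ^ a * S ^ (9 * a) := by
    have : V ≤ D * S ^ (9 : ℝ) := by
      have : V = S * (1 / τ ^ 2) := by rw [hV]; ring
      rw [this]
      calc S * (1 / τ ^ 2) ≤ S * (D * S ^ 8) := by gcongr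
        _ = D * S ^ 9 := by ring
        _ = _ := by norm_cast
    calc V ^ a ≤ (D * S ^ (9 : ℝ)) ^ a := by gcongr
      _ = _ := by rw [Real.mul_rpow hD.le (by positivity), ← Real.rpow_mul hS0.le]
  have hexp : Real.exp (-S / 4) ≤
      D ^ a * (2 ^ q * (2 * q) ^ q) * (S ^ (-(p + 1)) * V ^ (-a)) := by
    have e := rpow_mul_exp_neg_half_le (x := S / 2) hq0 (by positivity)
    rw [Real.div_rpow hS0.le (by norm_num), show -(S / 2) / 2 = -S / 4 by ring,
      div_mul_eq_mul_div, div_le_iff₀ (by positivity)] at e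
    have hqS : S ^ q = S ^ (p + 1) * S ^ (9 * a) := by
      rw [← Real.rpow_add hS0]; congr 1; rw [hq]; ring
    rw [Real.rpow_neg hS0.le, Real.rpow_neg hVpos.le, ← mul_inv, ← div_eq_mul_inv,
      le_div_iff₀ (by positivity)]
    calc Real.exp (-S / 4) * (S ^ (p + 1) * V ^ a)
        ≤ Real.exp (-S / 4) * (S ^ (p + 1) * (D ^ a * S ^ (9 * a))) := by gcongr
      _ = D ^ a * (S ^ q * Real.exp (-S / 4)) := by rw [hqS]; ring
      _ ≤ D ^ a * ((2 * q) ^ q * 2 ^ q) := by gcongr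
      _ = _ := by ring
  have hden0 : 0 < c * (S ^ (-p) * V ^ (-a)) := by positivity
  calc meanKappa a L τ k S
      ≤ (D ^ a * (2 ^ q * (2 * q) ^ q) + C) * (S ^ (-(p + 1)) * V ^ (-a)) /
          (c * (S ^ (-p) * V ^ (-a))) := by
        unfold meanKappa
        gcongr
        linarith
    _ = _ := by
        rw [show -(p + 1) = -p + -1 by ring, Real.rpow_add hS0, Real.rpow_neg_one]
        field_simp

end Moments

/-! ### Gaussian integrals over one group -/

section QuadraticForm

variable {k : ℕ} {Q : Matrix (Fin k) (Fin k) ℝ}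

lemma dotProduct_mulVec_comm (hQ : Q.PosDef) (x y : Fin k → ℝ) :
    x ⬝ᵥ (Q *ᵥ y) = y ⬝ᵥ (Q *ᵥ x) := by
  have hT : Qᵀ = Q := by simpa using hQ.isHermitian.eq
  rw [dotProduct_comm, dotProduct_mulVec, ← mulVec_transpose, hT]

lemma exists_coercive (hQ : Q.PosDef) :
    ∃ q : ℝ, 0 < q ∧ ∀ b : Fin k → ℝ, q * (b ⬝ᵥ b) ≤ b ⬝ᵥ (Q *ᵥ b) := by
  have : ∃ q : ℝ, 0 < q ∧ ∀ i, q ≤ hQ.isHermitian.eigenvalues i := by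
    rcases isEmpty_or_nonempty (Fin k) with he | he
    · exact ⟨1, one_pos, fun i => he.elim i⟩
    · obtain ⟨i, hi⟩ := Finite.exists_min hQ.isHermitian.eigenvalues
      exact ⟨_, hQ.eigenvalues_pos i, hi⟩
  obtain ⟨q, hq, hle⟩ := this
  refine ⟨q, hq, fun b => ?_⟩
  have h1 : algebraMap ℝ (Matrix (Fin k) (Fin k) ℝ) q ≤ Q := by
    refine algebraMap_le_of_le_spectrum ?_ hQ.isHermitian
    rw [hQ.isHermitian.spectrum_real_eq_range_eigenvalues]
    rintro _ ⟨i, rfl⟩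
    exact hle i
  have h2 := (Matrix.le_iff.1 h1).dotProduct_mulVec_nonneg b
  simpa [sub_mulVec, Algebra.algebraMap_eq_smul_one, smul_mulVec] using h2

lemma integrable_exp_neg_quadratic (hQ : Q.PosDef) {c : ℝ} (hc : 0 < c) :
    Integrable fun b : Fin k → ℝ => Real.exp (-c * (b ⬝ᵥ (Q *ᵥ b))) := by
  obtain ⟨q, hq, hle⟩ := exists_coercive hQ
  have h1 : Integrable fun b : Fin k → ℝ => ∏ i, Real.exp (-(c * q) * b i ^ 2) :=
    Integrable.fintype_prod fun _ => integrable_exp_neg_mul_sq (mul_pos hc hq)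
  refine h1.mono' (by fun_prop) (ae_of_all _ fun b => ?_)
  rw [Real.norm_of_nonneg (Real.exp_pos _).le, ← Real.exp_sum, Real.exp_le_exp,
    ← Finset.mul_sum]
  have h2 := hle b
  have h3 : b ⬝ᵥ b = ∑ i, b i ^ 2 := by simp [dotProduct, sq]
  rw [← h3]
  nlinarith

lemma integrable_coord_mul_exp_neg_quadratic (hQ : Q.PosDef) {c : ℝ} (hc : 0 < c) (j : Fin k) :
    Integrable fun b : Fin k → ℝ => b j * Real.exp (-c * (b ⬝ᵥ (Q *ᵥ b))) := by
  obtain ⟨q, hq, hle⟩ := exists_coercive hQ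
  refine ((integrable_exp_neg_quadratic hQ (half_pos hc)).const_mul (1 + 2 / (c * q))).mono'
    (by fun_prop) (ae_of_all _ fun b => ?_)
  set u := b ⬝ᵥ (Q *ᵥ b)
  have h1 : b j ^ 2 ≤ b ⬝ᵥ b := by
    have : b ⬝ᵥ b = ∑ i, b i ^ 2 := by simp [dotProduct, sq]
    rw [this]
    exact Finset.single_le_sum (f := fun i => b i ^ 2) (fun i _ => sq_nonneg _) (Finset.mem_univ j)
  have h2 : q * b j ^ 2 ≤ u := (mul_le_mul_of_nonneg_left h1 hq.le).trans (hle b)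
  have hu : 0 ≤ u := le_trans (by positivity) h2
  have h3 : c / 2 * u + 1 ≤ Real.exp (c / 2 * u) := Real.add_one_le_exp _
  have h4 : |b j| ≤ (1 + 2 / (c * q)) * Real.exp (c / 2 * u) := by
    have e1 : |b j| ≤ 1 + b j ^ 2 := by
      rw [← sq_abs]
      nlinarith [sq_nonneg (|b j| - 1), abs_nonneg (b j)]
    have e2 : b j ^ 2 ≤ 2 / (c * q) * (c / 2 * u) := by
      have : 2 / (c * q) * (c / 2 * u) = u / q := by field_simp
      rw [this, le_div_iff₀ hq]
      linarith
    have e3 : 0 ≤ c / 2 * u := by positivity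
    have e4 : 2 / (c * q) * (c / 2 * u) ≤ 2 / (c * q) * Real.exp (c / 2 * u) := by
      gcongr
      linarith
    linarith
  rw [norm_mul, Real.norm_of_nonneg (Real.exp_pos _).le, Real.norm_eq_abs]
  calc |b j| * Real.exp (-c * u)
      ≤ (1 + 2 / (c * q)) * Real.exp (c / 2 * u) * Real.exp (-c * u) := by gcongr
    _ = (1 + 2 / (c * q)) * Real.exp (-(c / 2) * u) := by
        rw [mul_assoc, ← Real.exp_add]
        ring_nf

/-- Scaling reduces the Gaussian integral to a constant of the quadratic form. -/
lemma integral_exp_neg_quadratic {c : ℝ} (hc : 0 < c) :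
    ∫ b : Fin k → ℝ, Real.exp (-c * (b ⬝ᵥ (Q *ᵥ b))) =
      c ^ (-((k : ℝ) / 2)) * ∫ b : Fin k → ℝ, Real.exp (-(b ⬝ᵥ (Q *ᵥ b))) := by
  have h := Measure.integral_comp_smul (volume : Measure (Fin k → ℝ))
    (fun b => Real.exp (-(b ⬝ᵥ (Q *ᵥ b)))) (√c)
  have e : ∀ b : Fin k → ℝ, -((√c • b) ⬝ᵥ (Q *ᵥ (√c • b))) = -c * (b ⬝ᵥ (Q *ᵥ b)) := fun b => by
    rw [mulVec_smul, smul_dotProduct, dotProduct_smul, smul_smul, Real.mul_self_sqrt hc.le,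
      smul_eq_mul, neg_mul]
  simp only [e] at h
  rw [h, abs_of_nonneg (by positivity), Module.finrank_fin_fun, smul_eq_mul,
    Real.rpow_neg hc.le, Real.sqrt_eq_rpow, ← Real.rpow_natCast, ← Real.rpow_mul hc.le]
  ring_nf

lemma integral_exp_neg_quadratic_sub (c : ℝ) (w : Fin k → ℝ) :
    ∫ b : Fin k → ℝ, Real.exp (-c * ((b - w) ⬝ᵥ (Q *ᵥ (b - w)))) =
      ∫ b : Fin k → ℝ, Real.exp (-c * (b ⬝ᵥ (Q *ᵥ b))) :=
  integral_sub_right_eq_self (fun b : Fin k → ℝ => Real.exp (-c * (b ⬝ᵥ (Q *ᵥ b)))) w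

lemma integral_coord_mul_exp_neg_quadratic_sub (hQ : Q.PosDef) {c : ℝ} (hc : 0 < c)
    (w : Fin k → ℝ) (j : Fin k) :
    ∫ b : Fin k → ℝ, b j * Real.exp (-c * ((b - w) ⬝ᵥ (Q *ᵥ (b - w)))) =
      w j * ∫ b : Fin k → ℝ, Real.exp (-c * (b ⬝ᵥ (Q *ᵥ b))) := by
  have h0 : ∫ b : Fin k → ℝ, b j * Real.exp (-c * (b ⬝ᵥ (Q *ᵥ b))) = 0 := by
    have h := integral_neg_eq_self
      (fun b : Fin k → ℝ => b j * Real.exp (-c * (b ⬝ᵥ (Q *ᵥ b)))) volume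
    simp only [Pi.neg_apply, mulVec_neg, dotProduct_neg, neg_dotProduct, neg_neg, neg_mul,
      integral_neg] at h
    simp only [neg_mul]
    linarith
  have h1 := integral_sub_right_eq_self (μ := volume)
    (fun b : Fin k → ℝ => (b j + w j) * Real.exp (-c * (b ⬝ᵥ (Q *ᵥ b)))) w
  simp only [Pi.sub_apply, sub_add_cancel] at h1
  rw [h1]
  simp only [add_mul]
  rw [integral_add (integrable_coord_mul_exp_neg_quadratic hQ hc j)
    ((integrable_exp_neg_quadratic hQ hc).const_mul _), h0, zero_add, integral_const_mul]

lemma integrable_exp_neg_quadratic_sub (hQ : Q.PosDef) {c : ℝ} (hc : 0 < c) (w : Fin k → ℝ) :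
    Integrable fun b : Fin k → ℝ => Real.exp (-c * ((b - w) ⬝ᵥ (Q *ᵥ (b - w)))) :=
  (integrable_exp_neg_quadratic hQ hc).comp_sub_right w

lemma integral_exp_neg_quadratic_pos (hQ : Q.PosDef) :
    0 < ∫ b : Fin k → ℝ, Real.exp (-(b ⬝ᵥ (Q *ᵥ b))) := by
  have h := integrable_exp_neg_quadratic hQ one_pos
  simp only [neg_mul, one_mul] at h
  exact integral_exp_pos h

end QuadraticForm

/-! ### The posterior of one group -/

/-- The factor that a group contributes to the joint density, as a function of `(λ², b)`: the
prior density times the part `exp ((vᵀb - bᵀQb/2) / σ²)` of the likelihood that involves `b`. Here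
`Q` stands for `X_gᵀ X_g` and `v` for `X_gᵀ y`. -/
noncomputable def groupFactor {k : ℕ} (Q : Matrix (Fin k) (Fin k) ℝ) (σ a : ℝ) (L : ℝ → ℝ) (τ : ℝ)
    (v : Fin k → ℝ) (x : ℝ × (Fin k → ℝ)) : ℝ :=
  localPriorDensity a L x.1 * gaussianDensity ((x.1 * σ ^ 2 * τ ^ 2) • Q⁻¹) x.2 *
    Real.exp ((v ⬝ᵥ x.2 - x.2 ⬝ᵥ (Q *ᵥ x.2) / 2) / σ ^ 2)

section GroupFactor

variable {k : ℕ} {Q : Matrix (Fin k) (Fin k) ℝ} {σ a : ℝ} {L : ℝ → ℝ} {τ : ℝ}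

lemma gaussianDensity_smul_inv (hQ : Q.PosDef) (σ : ℝ) {s : ℝ} (hs : 0 < s)
    (b : Fin k → ℝ) (hσ : 0 < σ) :
    gaussianDensity ((s * σ ^ 2) • Q⁻¹) b =
      s ^ (-((k : ℝ) / 2)) * (√((2 * Real.pi * σ ^ 2) ^ k * Q.det⁻¹))⁻¹ *
        Real.exp (-(b ⬝ᵥ (Q *ᵥ b)) / (2 * s * σ ^ 2)) := by
  have hdet := hQ.det_pos
  have hu : IsUnit Q.det := hdet.ne'.isUnit
  have hc : s * σ ^ 2 ≠ 0 := by positivity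
  have hinv : ((s * σ ^ 2) • Q⁻¹)⁻¹ = (s * σ ^ 2)⁻¹ • Q := by
    have : Invertible (s * σ ^ 2) := invertibleOfNonzero hc
    rw [Matrix.inv_smul _ _ (by rw [Matrix.det_nonsing_inv]; simpa using hu), invOf_eq_inv,
      Matrix.nonsing_inv_nonsing_inv _ hu]
  have hd : ((s * σ ^ 2) • Q⁻¹).det = s ^ k * ((σ ^ 2) ^ k * Q.det⁻¹) := by
    rw [Matrix.det_smul, Fintype.card_fin, Matrix.det_nonsing_inv, Ring.inverse_eq_inv', mul_pow,
      mul_assoc]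
  rw [gaussianDensity, hinv, hd, smul_mulVec, dotProduct_smul, smul_eq_mul]
  have e1 : √((2 * Real.pi) ^ k * (s ^ k * ((σ ^ 2) ^ k * Q.det⁻¹))) =
      s ^ ((k : ℝ) / 2) * √((2 * Real.pi * σ ^ 2) ^ k * Q.det⁻¹) := by
    rw [show (2 * Real.pi) ^ k * (s ^ k * ((σ ^ 2) ^ k * Q.det⁻¹)) =
      s ^ k * ((2 * Real.pi * σ ^ 2) ^ k * Q.det⁻¹) by rw [mul_pow (2 * Real.pi)]; ring,
      Real.sqrt_mul (by positivity)]
    congr 1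
    rw [Real.sqrt_eq_rpow, ← Real.rpow_natCast, ← Real.rpow_mul hs.le]
    ring_nf
  rw [e1, Real.rpow_neg hs.le, div_eq_mul_inv, mul_inv, mul_comm]
  congr 2
  all_goals field_simp

/-- The constant by which the marginal posterior density of `λ²` differs from `shrinkKernel`. -/
noncomputable def groupConst (Q : Matrix (Fin k) (Fin k) ℝ) (σ S : ℝ) : ℝ :=
  (√((2 * Real.pi * σ ^ 2) ^ k * Q.det⁻¹))⁻¹ * (2 * σ ^ 2) ^ ((k : ℝ) / 2) * Real.exp (S / 2) *
    ∫ b : Fin k → ℝ, Real.exp (-(b ⬝ᵥ (Q *ᵥ b)))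

lemma groupConst_pos (hQ : Q.PosDef) (hσ : 0 < σ) (S : ℝ) : 0 < groupConst Q σ S := by
  have h1 := integral_exp_neg_quadratic_pos hQ
  have h2 := hQ.det_pos
  have h3 := Real.pi_pos
  unfold groupConst
  positivity

/-- Completing the square: given `λ² = t`, the posterior of `b` is centred at `(1 - κ) w`, where
`Q w = v`. -/
lemma groupFactor_eq (hQ : Q.PosDef) (hσ : 0 < σ) (hτ : 0 < τ) (w : Fin k → ℝ) {t : ℝ}
    (ht : 0 < t) (b : Fin k → ℝ) :
    groupFactor Q σ a L τ (Q *ᵥ w) (t, b) =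
      localPriorDensity a L t * ((t * τ ^ 2) ^ (-((k : ℝ) / 2)) *
        (√((2 * Real.pi * σ ^ 2) ^ k * Q.det⁻¹))⁻¹ *
          Real.exp ((1 - kappa τ t) * (w ⬝ᵥ (Q *ᵥ w) / σ ^ 2) / 2)) *
        Real.exp (-(2 * (1 - kappa τ t) * σ ^ 2)⁻¹ *
          ((b - (1 - kappa τ t) • w) ⬝ᵥ (Q *ᵥ (b - (1 - kappa τ t) • w)))) := by
  have hs : 0 < t * τ ^ 2 := by positivity
  have hκ : 1 - kappa τ t = t * τ ^ 2 / (1 + t * τ ^ 2) := by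
    rw [kappa]
    field_simp
    ring
  rw [groupFactor]
  simp only
  rw [show t * σ ^ 2 * τ ^ 2 = (t * τ ^ 2) * σ ^ 2 by ring, gaussianDensity_smul_inv hQ σ hs b hσ]
  simp only [mul_assoc]
  congr 3
  rw [← Real.exp_add, ← Real.exp_add]
  congr 1
  have hwb : (Q *ᵥ w) ⬝ᵥ b = w ⬝ᵥ (Q *ᵥ b) := by
    rw [dotProduct_comm, dotProduct_mulVec_comm hQ]
  rw [hwb, mulVec_sub, mulVec_smul, dotProduct_sub, sub_dotProduct, sub_dotProduct,
    dotProduct_smul, dotProduct_smul, smul_dotProduct, smul_dotProduct,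
    dotProduct_mulVec_comm hQ b w, hκ]
  simp only [smul_eq_mul]
  field_simp
  ring

/-- The normalising factor of the prior of `b` given `λ² = t`, times the determinant factor of its
posterior, is a power of `κ`, because `1 - κ = t τ² κ`. -/
lemma rpow_mul_one_sub_kappa (hσ : 0 < σ) (hτ : 0 < τ) {t : ℝ} (ht : 0 < t) (r : ℝ) :
    (t * τ ^ 2) ^ (-r) * (2 * (1 - kappa τ t) * σ ^ 2)⁻¹ ^ (-r) =
      (2 * σ ^ 2) ^ r * kappa τ t ^ r := by
  have hs : 0 < t * τ ^ 2 := by positivity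
  have hκ : 1 - kappa τ t = t * τ ^ 2 * kappa τ t := by
    rw [kappa]
    field_simp
    ring
  have hκ0 := kappa_pos (τ := τ) ht.le
  rw [hκ, Real.rpow_neg hs.le, Real.inv_rpow (by positivity),
    Real.rpow_neg (by positivity), inv_inv,
    show 2 * (t * τ ^ 2 * kappa τ t) * σ ^ 2 = t * τ ^ 2 * (2 * σ ^ 2 * kappa τ t) by ring,
    Real.mul_rpow hs.le (by positivity), Real.mul_rpow (by positivity) hκ0.le]
  field_simp

/-- Integrating out `b` leaves the marginal posterior density of `λ²`. For `t ≤ 0` both sides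
vanish with the prior density. -/
lemma integral_groupFactor_snd (hQ : Q.PosDef) (hσ : 0 < σ) (hτ : 0 < τ) (w : Fin k → ℝ) (t : ℝ) :
    ∫ b, groupFactor Q σ a L τ (Q *ᵥ w) (t, b) =
      groupConst Q σ (w ⬝ᵥ (Q *ᵥ w) / σ ^ 2) *
        shrinkKernel a L τ (w ⬝ᵥ (Q *ᵥ w) / σ ^ 2) (k / 2) t := by
  rcases le_or_gt t 0 with ht | ht
  · simp [groupFactor, shrinkKernel, localPriorDensity_of_nonpos ht]
  have hκ1 : 0 < 1 - kappa τ t := by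
    rw [kappa, sub_pos, div_lt_one (by positivity)]
    have : 0 < t * τ ^ 2 := by positivity
    linarith
  simp only [groupFactor_eq hQ hσ hτ w ht]
  rw [integral_const_mul, integral_exp_neg_quadratic_sub,
    integral_exp_neg_quadratic (by positivity), shrinkKernel, groupConst]
  set S := w ⬝ᵥ (Q *ᵥ w) / σ ^ 2
  set I := ∫ b : Fin k → ℝ, Real.exp (-(b ⬝ᵥ (Q *ᵥ b)))
  set N := (√((2 * Real.pi * σ ^ 2) ^ k * Q.det⁻¹))⁻¹
  have e1 : Real.exp ((1 - kappa τ t) * S / 2) =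
      Real.exp (S / 2) * Real.exp (-(kappa τ t * S) / 2) := by
    rw [← Real.exp_add]; ring_nf
  rw [e1]
  calc _ = localPriorDensity a L t * N * Real.exp (S / 2) * Real.exp (-(kappa τ t * S) / 2) * I *
        ((t * τ ^ 2) ^ (-((k : ℝ) / 2)) *
          (2 * (1 - kappa τ t) * σ ^ 2)⁻¹ ^ (-((k : ℝ) / 2))) := by ring
    _ = _ := by rw [rpow_mul_one_sub_kappa hσ hτ ht]; ring

lemma integral_coord_mul_groupFactor_snd (hQ : Q.PosDef) (hσ : 0 < σ) (hτ : 0 < τ)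
    (w : Fin k → ℝ) (j : Fin k) (t : ℝ) :
    ∫ b : Fin k → ℝ, b j * groupFactor Q σ a L τ (Q *ᵥ w) (t, b) =
      w j * ((1 - kappa τ t) * ∫ b, groupFactor Q σ a L τ (Q *ᵥ w) (t, b)) := by
  rcases le_or_gt t 0 with ht | ht
  · simp [groupFactor, localPriorDensity_of_nonpos ht]
  have hκ1 : 0 < 1 - kappa τ t := by
    rw [kappa, sub_pos, div_lt_one (by positivity)]
    have : 0 < t * τ ^ 2 := by positivity
    linarith
  simp only [groupFactor_eq hQ hσ hτ w ht, mul_left_comm (_ : ℝ) (localPriorDensity a L t * _)]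
  rw [integral_const_mul, integral_const_mul,
    integral_coord_mul_exp_neg_quadratic_sub hQ (by positivity), integral_exp_neg_quadratic_sub,
    Pi.smul_apply, smul_eq_mul]
  ring

lemma integrable_groupFactor_snd (hQ : Q.PosDef) (hσ : 0 < σ) (hτ : 0 < τ) (w : Fin k → ℝ)
    (t : ℝ) : Integrable fun b => groupFactor Q σ a L τ (Q *ᵥ w) (t, b) := by
  rcases le_or_gt t 0 with ht | ht
  · simp [groupFactor, localPriorDensity_of_nonpos ht]
  have hκ1 : 0 < 1 - kappa τ t := by
    rw [kappa, sub_pos, div_lt_one (by positivity)]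
    have : 0 < t * τ ^ 2 := by positivity
    linarith
  simp only [groupFactor_eq hQ hσ hτ w ht]
  exact (integrable_exp_neg_quadratic_sub hQ (by positivity) _).const_mul _

end GroupFactor

/-! ### Measurability -/

section Measurability

lemma measurable_gaussianDensity {k : ℕ} (S : Matrix (Fin k) (Fin k) ℝ) :
    Measurable (gaussianDensity S) := by
  unfold gaussianDensity
  exact Continuous.measurable (by fun_prop)

/-- The inverse is written as adjugate over determinant, which is measurable without any assumption
on the matrix. -/
lemma measurable_gaussianDensity_smul {k : ℕ} (c d : ℝ) (A : Matrix (Fin k) (Fin k) ℝ) :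
    Measurable fun x : ℝ × (Fin k → ℝ) => gaussianDensity ((x.1 * c * d) • A) x.2 := by
  have h1 : Measurable fun x : ℝ × (Fin k → ℝ) => ((x.1 * c * d) • A).det :=
    Continuous.measurable (by fun_prop)
  have h2 : Measurable fun x : ℝ × (Fin k → ℝ) =>
      x.2 ⬝ᵥ (((x.1 * c * d) • A).adjugate *ᵥ x.2) :=
    Continuous.measurable (by fun_prop)
  simp only [gaussianDensity, Matrix.inv_def, Ring.inverse_eq_inv', smul_mulVec, dotProduct_smul,
    smul_eq_mul]
  fun_prop

lemma measurable_groupFactor {k : ℕ} {a : ℝ} {L : ℝ → ℝ} (h : PolynomialTailPrior a L)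
    (Q : Matrix (Fin k) (Fin k) ℝ) (σ τ : ℝ) (v : Fin k → ℝ) :
    Measurable (groupFactor Q σ a L τ v) := by
  have h1 := measurable_localPriorDensity h
  have h2 := measurable_gaussianDensity_smul (σ ^ 2) (τ ^ 2) Q⁻¹
  have h3 : Measurable fun x : ℝ × (Fin k → ℝ) =>
      Real.exp ((v ⬝ᵥ x.2 - x.2 ⬝ᵥ (Q *ᵥ x.2) / 2) / σ ^ 2) :=
    Continuous.measurable (by fun_prop)
  exact ((h1.comp measurable_fst).mul h2).mul h3

variable {n G : ℕ} {m : Fin G → ℕ}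

lemma measurable_jointDensity {a : ℝ} {L : ℝ → ℝ} (h : PolynomialTailPrior a L)
    (X : Matrix (Fin n) (Σ g, Fin (m g)) ℝ) (σ τ : ℝ) :
    Measurable fun p : (Fin n → ℝ) × Param m => jointDensity X σ a L τ p.1 p.2 := by
  unfold jointDensity
  refine Measurable.mul ?_ (Finset.measurable_prod _ fun g _ => ?_)
  · refine (measurable_gaussianDensity _).comp (Continuous.measurable ?_)
    unfold linPred
    fun_prop
  · have hg : Measurable fun p : (Fin n → ℝ) × Param m => p.2 g := by fun_prop
    exact ((measurable_localPriorDensity h).comp (measurable_fst.comp hg)).mul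
      ((measurable_gaussianDensity_smul (σ ^ 2) (τ ^ 2) _).comp hg)

lemma measurable_posteriorExp {a : ℝ} {L : ℝ → ℝ} (h : PolynomialTailPrior a L)
    (X : Matrix (Fin n) (Σ g, Fin (m g)) ℝ) (σ τ : ℝ) {f : Param m → ℝ} (hf : Measurable f) :
    Measurable fun y => posteriorExp X σ a L τ y f := by
  have h1 := measurable_jointDensity h X σ τ
  have h2 : Measurable fun p : (Fin n → ℝ) × Param m => f p.2 * jointDensity X σ a L τ p.1 p.2 :=
    (hf.comp measurable_snd).mul h1
  exact (StronglyMeasurable.integral_prod_right (ν := (volume : Measure (Param m)))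
    (f := fun y θ => f θ * jointDensity X σ a L τ y θ) h2.stronglyMeasurable).measurable.div
    (StronglyMeasurable.integral_prod_right (ν := (volume : Measure (Param m)))
    (f := fun y θ => jointDensity X σ a L τ y θ) h1.stronglyMeasurable).measurable

lemma measurable_htEstimator {a : ℝ} {L : ℝ → ℝ} (h : PolynomialTailPrior a L)
    (X : Matrix (Fin n) (Σ g, Fin (m g)) ℝ) (σ τ : ℝ) (g : Fin G) :
    Measurable fun y => htEstimator X σ a L τ y g := by
  unfold htEstimator
  refine Measurable.ite (measurableSet_lt measurable_const ?_) ?_ measurable_const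
  · refine measurable_posteriorExp h X σ τ ?_
    have := measurable_kappa τ
    fun_prop
  · exact measurable_pi_lambda _ fun j => measurable_posteriorExp h X σ τ (by fun_prop)

lemma measurable_activeStatistic_htEstimator {a : ℝ} {L : ℝ → ℝ} (h : PolynomialTailPrior a L)
    (X : Matrix (Fin n) (Σ g, Fin (m g)) ℝ) (σ τ : ℝ) (β : ∀ g, Fin (m g) → ℝ)
    (α : EuclideanSpace ℝ (ActiveIdx β)) :
    Measurable fun y => activeStatistic X β α (htEstimator X σ a L τ y) := by
  have h1 : Continuous fun b : ∀ g, Fin (m g) → ℝ => activeStatistic X β α b := by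
    unfold activeStatistic
    fun_prop
  exact h1.measurable.comp (measurable_pi_lambda _ fun g => measurable_htEstimator h X σ τ g)

end Measurability

/-! ### Posterior expectations -/

section Posterior

variable {k : ℕ} {Q : Matrix (Fin k) (Fin k) ℝ} {σ a : ℝ} {L : ℝ → ℝ} {τ : ℝ}

lemma groupFactor_nonneg (h : PolynomialTailPrior a L) (v : Fin k → ℝ) (x : ℝ × (Fin k → ℝ)) :
    0 ≤ groupFactor Q σ a L τ v x := by
  have := localPriorDensity_nonneg h x.1
  unfold groupFactor gaussianDensity
  positivity

/-- By Tonelli's theorem; every `v` is of the form `Q w`. -/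
lemma integrable_groupFactor (h : PolynomialTailPrior a L) (hQ : Q.PosDef) (hσ : 0 < σ)
    (hτ : 0 < τ) (v : Fin k → ℝ) : Integrable (groupFactor Q σ a L τ v) := by
  obtain ⟨w, rfl⟩ : ∃ w, Q *ᵥ w = v :=
    ⟨Q⁻¹ *ᵥ v, by rw [mulVec_mulVec, Matrix.mul_nonsing_inv _ hQ.det_pos.ne'.isUnit, one_mulVec]⟩
  have hS : 0 ≤ w ⬝ᵥ (Q *ᵥ w) / σ ^ 2 :=
    div_nonneg (by simpa using hQ.posSemidef.dotProduct_mulVec_nonneg w) (by positivity)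
  refine (integrable_prod_iff (measurable_groupFactor h Q σ τ _).aestronglyMeasurable).2
    ⟨ae_of_all _ fun t => integrable_groupFactor_snd hQ hσ hτ w t, ?_⟩
  simp only [Real.norm_of_nonneg (groupFactor_nonneg h _ _), integral_groupFactor_snd hQ hσ hτ]
  exact (integrable_shrinkKernel h hS (by positivity)).const_mul _

/-- Tilting by `exp (± b_j)` changes `v` only, so that the first moment is dominated by two group
factors. -/
lemma integrable_coord_mul_groupFactor (h : PolynomialTailPrior a L) (hQ : Q.PosDef) (hσ : 0 < σ)
    (hτ : 0 < τ) (v : Fin k → ℝ) (j : Fin k) :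
    Integrable fun x : ℝ × (Fin k → ℝ) => x.2 j * groupFactor Q σ a L τ v x := by
  have hm := measurable_groupFactor h Q σ τ v
  have hσ2 : σ ^ 2 ≠ 0 := by positivity
  refine ((integrable_groupFactor h hQ hσ hτ (v + Pi.single j (σ ^ 2))).add
    (integrable_groupFactor h hQ hσ hτ (v - Pi.single j (σ ^ 2)))).mono'
    (Measurable.aestronglyMeasurable (by fun_prop)) (ae_of_all _ fun x => ?_)
  have e1 : groupFactor Q σ a L τ (v + Pi.single j (σ ^ 2)) x =
      Real.exp (x.2 j) * groupFactor Q σ a L τ v x := by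
    unfold groupFactor
    rw [mul_comm (Real.exp _), mul_assoc (_ * _) (Real.exp _) (Real.exp _), ← Real.exp_add,
      add_dotProduct, single_dotProduct]
    congr 2
    field_simp
    ring
  have e2 : groupFactor Q σ a L τ (v - Pi.single j (σ ^ 2)) x =
      Real.exp (-x.2 j) * groupFactor Q σ a L τ v x := by
    unfold groupFactor
    rw [mul_comm (Real.exp _), mul_assoc (_ * _) (Real.exp _) (Real.exp _), ← Real.exp_add,
      sub_dotProduct, single_dotProduct]
    congr 2
    field_simp
    ring
  rw [Pi.add_apply, e1, e2, ← add_mul, norm_mul, Real.norm_of_nonneg (groupFactor_nonneg h _ _),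
    Real.norm_eq_abs]
  refine mul_le_mul_of_nonneg_right ?_ (groupFactor_nonneg h _ _)
  have h1 := Real.add_one_le_exp (x.2 j)
  have h2 := Real.add_one_le_exp (-x.2 j)
  have h3 := Real.exp_pos (x.2 j)
  have h4 := Real.exp_pos (-x.2 j)
  rw [abs_le]
  constructor <;> linarith

lemma abs_one_sub_kappa_mul_groupFactor_le (h : PolynomialTailPrior a L) (v : Fin k → ℝ)
    (x : ℝ × (Fin k → ℝ)) :
    |(1 - kappa τ x.1) * groupFactor Q σ a L τ v x| ≤ groupFactor Q σ a L τ v x := by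
  rcases le_or_gt x.1 0 with ht | ht
  · simp [groupFactor, localPriorDensity_of_nonpos ht]
  · have h1 := kappa_pos (τ := τ) ht.le
    have h2 := kappa_le_one (τ := τ) ht.le
    rw [abs_of_nonneg (mul_nonneg (by linarith) (groupFactor_nonneg h v x))]
    exact mul_le_of_le_one_left (groupFactor_nonneg h v x) (by linarith)

lemma integrable_one_sub_kappa_mul_groupFactor (h : PolynomialTailPrior a L) (hQ : Q.PosDef)
    (hσ : 0 < σ) (hτ : 0 < τ) (v : Fin k → ℝ) :
    Integrable fun x : ℝ × (Fin k → ℝ) => (1 - kappa τ x.1) * groupFactor Q σ a L τ v x := by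
  have hm := measurable_groupFactor h Q σ τ v
  have hκ := measurable_kappa τ
  exact (integrable_groupFactor h hQ hσ hτ v).mono'
    (Measurable.aestronglyMeasurable (by fun_prop))
    (ae_of_all _ fun x => abs_one_sub_kappa_mul_groupFactor_le h v x)

lemma integral_groupFactor (h : PolynomialTailPrior a L) (hQ : Q.PosDef) (hσ : 0 < σ)
    (hτ : 0 < τ) (w : Fin k → ℝ) :
    ∫ x, groupFactor Q σ a L τ (Q *ᵥ w) x = groupConst Q σ (w ⬝ᵥ (Q *ᵥ w) / σ ^ 2) *
      ∫ t, shrinkKernel a L τ (w ⬝ᵥ (Q *ᵥ w) / σ ^ 2) (k / 2) t := by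
  rw [Measure.volume_eq_prod, integral_prod _ (integrable_groupFactor h hQ hσ hτ _)]
  simp only [integral_groupFactor_snd hQ hσ hτ]
  rw [integral_const_mul]

lemma integral_groupFactor_pos (h : PolynomialTailPrior a L) (hQ : Q.PosDef) (hσ : 0 < σ)
    (hτ : 0 < τ) (v : Fin k → ℝ) : 0 < ∫ x, groupFactor Q σ a L τ v x := by
  obtain ⟨w, rfl⟩ : ∃ w, Q *ᵥ w = v :=
    ⟨Q⁻¹ *ᵥ v, by rw [mulVec_mulVec, Matrix.mul_nonsing_inv _ hQ.det_pos.ne'.isUnit, one_mulVec]⟩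
  have hS : 0 ≤ w ⬝ᵥ (Q *ᵥ w) / σ ^ 2 :=
    div_nonneg (by simpa using hQ.posSemidef.dotProduct_mulVec_nonneg w) (by positivity)
  rw [integral_groupFactor h hQ hσ hτ]
  exact mul_pos (groupConst_pos hQ hσ _) (integral_shrinkKernel_pos h hS (by positivity))

lemma integral_one_sub_kappa_mul_groupFactor (h : PolynomialTailPrior a L) (hQ : Q.PosDef)
    (hσ : 0 < σ) (hτ : 0 < τ) (w : Fin k → ℝ) :
    ∫ x : ℝ × (Fin k → ℝ), (1 - kappa τ x.1) * groupFactor Q σ a L τ (Q *ᵥ w) x =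
      (1 - meanKappa a L τ k (w ⬝ᵥ (Q *ᵥ w) / σ ^ 2)) *
        ∫ x, groupFactor Q σ a L τ (Q *ᵥ w) x := by
  have hS : 0 ≤ w ⬝ᵥ (Q *ᵥ w) / σ ^ 2 :=
    div_nonneg (by simpa using hQ.posSemidef.dotProduct_mulVec_nonneg w) (by positivity)
  rw [integral_groupFactor h hQ hσ hτ, Measure.volume_eq_prod,
    integral_prod _ (integrable_one_sub_kappa_mul_groupFactor h hQ hσ hτ _)]
  simp only [integral_const_mul, integral_groupFactor_snd hQ hσ hτ]
  set S := w ⬝ᵥ (Q *ᵥ w) / σ ^ 2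
  have e : ∀ t, (1 - kappa τ t) * (groupConst Q σ S * shrinkKernel a L τ S (k / 2) t) =
      groupConst Q σ S *
        (shrinkKernel a L τ S (k / 2) t - shrinkKernel a L τ S (k / 2 + 1) t) := fun t => by
    rcases le_or_gt t 0 with ht | ht
    · simp [shrinkKernel, localPriorDensity_of_nonpos ht]
    · rw [shrinkKernel, shrinkKernel, Real.rpow_add_one (kappa_pos ht.le).ne']
      ring
  have hpos := integral_shrinkKernel_pos (τ := τ) (p := (k : ℝ) / 2) h hS (by positivity)
  simp only [e]
  rw [integral_const_mul, integral_sub (integrable_shrinkKernel h hS (by positivity))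
    (integrable_shrinkKernel h hS (by positivity)), meanKappa]
  field_simp

lemma integral_coord_mul_groupFactor (h : PolynomialTailPrior a L) (hQ : Q.PosDef)
    (hσ : 0 < σ) (hτ : 0 < τ) (w : Fin k → ℝ) (j : Fin k) :
    ∫ x : ℝ × (Fin k → ℝ), x.2 j * groupFactor Q σ a L τ (Q *ᵥ w) x =
      w j * ∫ x : ℝ × (Fin k → ℝ), (1 - kappa τ x.1) * groupFactor Q σ a L τ (Q *ᵥ w) x := by
  rw [Measure.volume_eq_prod, integral_prod _ (integrable_coord_mul_groupFactor h hQ hσ hτ _ j),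
    integral_prod _ (integrable_one_sub_kappa_mul_groupFactor h hQ hσ hτ _)]
  simp only [integral_coord_mul_groupFactor_snd hQ hσ hτ, integral_const_mul]

variable {n G : ℕ} {m : Fin G → ℕ} {X : Matrix (Fin n) (Σ g, Fin (m g)) ℝ}

/-- By block orthogonality the joint density is a product over the groups, up to a factor that
depends on `y` only. -/
lemma exists_jointDensity_eq (hX : BlockOrthogonal X) (hσ : 0 < σ) (a : ℝ) (L : ℝ → ℝ) (τ : ℝ)
    (y : Fin n → ℝ) :
    ∃ c : ℝ, c ≠ 0 ∧ ∀ θ : Param m, jointDensity X σ a L τ y θ =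
      c * ∏ g, groupFactor ((block X g)ᵀ * block X g) σ a L τ ((block X g)ᵀ *ᵥ y) (θ g) := by
  have hdet : 0 < (σ ^ 2 • (1 : Matrix (Fin n) (Fin n) ℝ)).det := by
    rw [Matrix.det_smul, Matrix.det_one]
    positivity
  have hinv : (σ ^ 2 • (1 : Matrix (Fin n) (Fin n) ℝ))⁻¹ = (σ ^ 2)⁻¹ • 1 := by
    refine Matrix.inv_eq_left_inv ?_
    rw [smul_mul_smul_comm, inv_mul_cancel₀ (by positivity), one_smul, one_mul]
  have hpi := Real.pi_pos
  refine ⟨Real.exp (-(y ⬝ᵥ y) / (2 * σ ^ 2)) /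
    √((2 * Real.pi) ^ n * (σ ^ 2 • (1 : Matrix (Fin n) (Fin n) ℝ)).det), by positivity, ?_⟩
  intro θ
  have hlin : y ⬝ᵥ linPred X (fun g => (θ g).2) =
      ∑ g, ((block X g)ᵀ *ᵥ y) ⬝ᵥ (θ g).2 := by
    rw [linPred, dotProduct_sum]
    refine Finset.sum_congr rfl fun g _ => ?_
    rw [dotProduct_mulVec, ← mulVec_transpose]
  have hquad : linPred X (fun g => (θ g).2) ⬝ᵥ linPred X (fun g => (θ g).2) =
      ∑ g, (θ g).2 ⬝ᵥ (((block X g)ᵀ * block X g) *ᵥ (θ g).2) := by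
    rw [linPred, sum_dotProduct]
    refine Finset.sum_congr rfl fun g _ => ?_
    have e : ∀ h, (block X g *ᵥ (θ g).2) ⬝ᵥ (block X h *ᵥ (θ h).2) =
        (θ g).2 ⬝ᵥ (((block X g)ᵀ * block X h) *ᵥ (θ h).2) := fun h => by
      rw [← mulVec_mulVec, dotProduct_mulVec, dotProduct_mulVec, vecMul_transpose,
        dotProduct_mulVec]
    rw [dotProduct_sum, Finset.sum_eq_single g]
    · exact e g
    · intro h _ hne
      rw [e, hX g h hne.symm, zero_mulVec, dotProduct_zero]
    · simp
  have hexp : ∏ g, Real.exp ((((block X g)ᵀ *ᵥ y) ⬝ᵥ (θ g).2 -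
      (θ g).2 ⬝ᵥ (((block X g)ᵀ * block X g) *ᵥ (θ g).2) / 2) / σ ^ 2) =
      Real.exp ((y ⬝ᵥ linPred X (fun g => (θ g).2) -
        linPred X (fun g => (θ g).2) ⬝ᵥ linPred X (fun g => (θ g).2) / 2) / σ ^ 2) := by
    rw [← Real.exp_sum, hlin, hquad, Finset.sum_div, ← Finset.sum_sub_distrib, Finset.sum_div]
  unfold jointDensity groupFactor
  simp only [Finset.prod_mul_distrib]
  rw [hexp, gaussianDensity, hinv, smul_mulVec, one_mulVec,
    dotProduct_smul, smul_eq_mul]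
  set u := linPred X (fun g => (θ g).2)
  have hsq : (y - u) ⬝ᵥ (y - u) = y ⬝ᵥ y - 2 * (y ⬝ᵥ u) + u ⬝ᵥ u := by
    rw [dotProduct_sub, sub_dotProduct, sub_dotProduct, dotProduct_comm u y]
    ring
  have hsplit : Real.exp (-((σ ^ 2)⁻¹ * ((y - u) ⬝ᵥ (y - u))) / 2) =
      Real.exp (-(y ⬝ᵥ y) / (2 * σ ^ 2)) * Real.exp ((y ⬝ᵥ u - u ⬝ᵥ u / 2) / σ ^ 2) := by
    rw [← Real.exp_add, hsq]
    congr 1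
    field_simp
    ring
  rw [hsplit]
  ring

/-- A posterior expectation that concerns one group is computed within the group. -/
lemma posteriorExp_eq_div (hprior : PolynomialTailPrior a L) (hX : BlockOrthogonal X)
    (hQ : ∀ g, ((block X g)ᵀ * block X g).PosDef) (hσ : 0 < σ) (hτ : 0 < τ) (y : Fin n → ℝ)
    (g : Fin G) (f : ℝ × (Fin (m g) → ℝ) → ℝ) :
    posteriorExp X σ a L τ y (fun θ => f (θ g)) =
      (∫ x, f x * groupFactor ((block X g)ᵀ * block X g) σ a L τ ((block X g)ᵀ *ᵥ y) x) /
        ∫ x, groupFactor ((block X g)ᵀ * block X g) σ a L τ ((block X g)ᵀ *ᵥ y) x := by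
  obtain ⟨c, hc, hjoint⟩ := exists_jointDensity_eq hX hσ a L τ y
  set F : ∀ g : Fin G, ℝ × (Fin (m g) → ℝ) → ℝ := fun g =>
    groupFactor ((block X g)ᵀ * block X g) σ a L τ ((block X g)ᵀ *ᵥ y) with hF
  have hpos : ∀ g, 0 < ∫ x, F g x := fun g => integral_groupFactor_pos hprior (hQ g) hσ hτ _
  have hden : ∫ θ : Param m, jointDensity X σ a L τ y θ =
      c * ((∫ x, F g x) * ∏ i ∈ Finset.univ.erase g, ∫ x, F i x) := by
    simp only [hjoint]
    rw [integral_const_mul, Finset.mul_prod_erase _ (fun i => ∫ x, F i x) (Finset.mem_univ g)]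
    congr 1
    exact integral_fintype_prod_volume_eq_prod F
  have hnum : ∫ θ : Param m, f (θ g) * jointDensity X σ a L τ y θ =
      c * ((∫ x, f x * F g x) * ∏ i ∈ Finset.univ.erase g, ∫ x, F i x) := by
    have e : ∀ θ : Param m, f (θ g) * jointDensity X σ a L τ y θ =
        c * ∏ i, Function.update F g (fun x => f x * F g x) i (θ i) := fun θ => by
      have e' : ∏ i ∈ Finset.univ.erase g, Function.update F g (fun x => f x * F g x) i (θ i) =
          ∏ i ∈ Finset.univ.erase g, F i (θ i) := Finset.prod_congr rfl fun i hi => by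
        rw [Function.update_of_ne (Finset.ne_of_mem_erase hi)]
      rw [hjoint, ← Finset.mul_prod_erase _ _ (Finset.mem_univ g),
        ← Finset.mul_prod_erase _ (fun i => Function.update F g _ i (θ i)) (Finset.mem_univ g),
        Function.update_self, e']
      ring
    simp only [e]
    rw [integral_const_mul]
    congr 1
    refine (integral_fintype_prod_volume_eq_prod _).trans ?_
    rw [← Finset.mul_prod_erase _ _ (Finset.mem_univ g), Function.update_self]
    congr 1
    exact Finset.prod_congr rfl fun i hi => by
      rw [Function.update_of_ne (Finset.ne_of_mem_erase hi)]
  have h1 : ∏ i ∈ Finset.univ.erase g, ∫ x, F i x ≠ 0 :=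
    Finset.prod_ne_zero_iff.2 fun i _ => (hpos i).ne'
  rw [posteriorExp, hnum, hden, mul_div_mul_left _ _ hc, mul_div_mul_right _ _ h1]

/-- Posterior shrinkage in terms of the least squares estimate `w` of the group, which solves
`X_gᵀ X_g w = X_gᵀ y`. -/
lemma shrinkWeight_eq (hprior : PolynomialTailPrior a L) (hX : BlockOrthogonal X)
    (hQ : ∀ g, ((block X g)ᵀ * block X g).PosDef) (hσ : 0 < σ) (hτ : 0 < τ) (y : Fin n → ℝ)
    (g : Fin G) {w : Fin (m g) → ℝ} (hw : ((block X g)ᵀ * block X g) *ᵥ w = (block X g)ᵀ *ᵥ y) :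
    shrinkWeight X σ a L τ y g =
      1 - meanKappa a L τ (m g) (w ⬝ᵥ (((block X g)ᵀ * block X g) *ᵥ w) / σ ^ 2) := by
  rw [shrinkWeight, posteriorExp_eq_div hprior hX hQ hσ hτ y g (fun x => 1 - kappa τ x.1), ← hw,
    integral_one_sub_kappa_mul_groupFactor hprior (hQ g) hσ hτ]
  exact mul_div_cancel_right₀ _ (integral_groupFactor_pos hprior (hQ g) hσ hτ _).ne'

lemma posteriorMean_eq (hprior : PolynomialTailPrior a L) (hX : BlockOrthogonal X)
    (hQ : ∀ g, ((block X g)ᵀ * block X g).PosDef) (hσ : 0 < σ) (hτ : 0 < τ) (y : Fin n → ℝ)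
    (g : Fin G) {w : Fin (m g) → ℝ} (hw : ((block X g)ᵀ * block X g) *ᵥ w = (block X g)ᵀ *ᵥ y) :
    posteriorMean X σ a L τ y g = shrinkWeight X σ a L τ y g • w := by
  ext j
  rw [posteriorMean, shrinkWeight, Pi.smul_apply, smul_eq_mul,
    posteriorExp_eq_div hprior hX hQ hσ hτ y g (fun x => x.2 j),
    posteriorExp_eq_div hprior hX hQ hσ hτ y g (fun x => 1 - kappa τ x.1), ← hw,
    integral_coord_mul_groupFactor hprior (hQ g) hσ hτ]
  ring

/-- The half-thresholding estimator multiplies the least squares estimate of the group by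
`1 - ρ`, where `ρ` is the posterior mean of `κ`, or `1` if that mean is at least `1/2`; in both
cases `ρ` is at most twice the posterior mean of `κ`. -/
lemma exists_htEstimator_eq (hprior : PolynomialTailPrior a L) (hX : BlockOrthogonal X)
    (hQ : ∀ g, ((block X g)ᵀ * block X g).PosDef) (hσ : 0 < σ) (hτ : 0 < τ) (y : Fin n → ℝ)
    (g : Fin G) {w : Fin (m g) → ℝ} (hw : ((block X g)ᵀ * block X g) *ᵥ w = (block X g)ᵀ *ᵥ y) :
    ∃ ρ : ℝ, 0 ≤ ρ ∧
      ρ ≤ 2 * meanKappa a L τ (m g) (w ⬝ᵥ (((block X g)ᵀ * block X g) *ᵥ w) / σ ^ 2) ∧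
      htEstimator X σ a L τ y g = (1 - ρ) • w := by
  have h1 := shrinkWeight_eq hprior hX hQ hσ hτ y g hw
  have h0 := meanKappa_nonneg hprior τ (m g) (w ⬝ᵥ (((block X g)ᵀ * block X g) *ᵥ w) / σ ^ 2)
  unfold htEstimator
  split_ifs with hc
  · exact ⟨_, h0, by linarith, by rw [posteriorMean_eq hprior hX hQ hσ hτ y g hw, h1]⟩
  · exact ⟨1, zero_le_one, by linarith, by simp⟩

end Posterior

/-! ### Gaussian linear functionals and convergence in distribution -/

section Probability

variable {n : ℕ}

lemma hasLaw_dotProduct_gaussian (v : NNReal) {u : Fin n → ℝ} (hu : u ⬝ᵥ u = 1) :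
    HasLaw (fun x => u ⬝ᵥ x) (gaussianReal 0 v) (Measure.pi fun _ : Fin n => gaussianReal 0 v) where
  aemeasurable := Continuous.aemeasurable (by fun_prop)
  map_eq := by
    have hm : Measurable fun x : Fin n → ℝ => u ⬝ᵥ x := Continuous.measurable (by fun_prop)
    have : IsProbabilityMeasure
        ((Measure.pi fun _ : Fin n => gaussianReal 0 v).map fun x => u ⬝ᵥ x) :=
      Measure.isProbabilityMeasure_map hm.aemeasurable
    refine Measure.ext_of_charFun ?_
    ext t
    rw [charFun_gaussianReal, charFun_apply_real,
      integral_map hm.aemeasurable (by fun_prop)]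
    have e : ∀ x : Fin n → ℝ, Complex.exp (t * ((u ⬝ᵥ x : ℝ) : ℂ) * Complex.I) =
        ∏ i, Complex.exp (((t * u i : ℝ) : ℂ) * (x i : ℂ) * Complex.I) := fun x => by
      rw [← Complex.exp_sum, dotProduct, Complex.ofReal_sum, Finset.mul_sum, Finset.sum_mul]
      congr 1
      refine Finset.sum_congr rfl fun i _ => ?_
      push_cast
      ring
    simp only [e]
    rw [integral_fintype_prod_eq_prod (μ := fun _ : Fin n => gaussianReal 0 v)
      (fun i (x : ℝ) => Complex.exp (((t * u i : ℝ) : ℂ) * (x : ℂ) * Complex.I))]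
    simp only [← charFun_apply_real, charFun_gaussianReal]
    rw [← Complex.exp_sum]
    congr 1
    have hu' : ∑ i, (u i : ℂ) ^ 2 = 1 := by
      have : ∑ i, u i ^ 2 = 1 := by rw [← hu]; simp [dotProduct, sq]
      exact_mod_cast this
    have : ∀ i, ((t * u i : ℝ) : ℂ) * ((0 : ℝ) : ℂ) * Complex.I -
        (v : ℂ) * ((t * u i : ℝ) : ℂ) ^ 2 / 2 = -((v : ℂ) * t ^ 2 / 2) * (u i : ℂ) ^ 2 :=
        fun i => by
      push_cast
      ring
    simp only [this]
    rw [← Finset.mul_sum, hu']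
    push_cast
    ring

/-- The second moment of the coordinates of `Uᵀ x` for a standard Gaussian vector `x`, scaled to
variance `v`, and a matrix `U` with orthonormal columns. -/
lemma integrable_and_integral_sq_transpose_mulVec {ι : Type*} [Fintype ι] [DecidableEq ι]
    (v : NNReal) {U : Matrix (Fin n) ι ℝ} (hU : Uᵀ * U = 1) :
    Integrable (fun x => (Uᵀ *ᵥ x) ⬝ᵥ (Uᵀ *ᵥ x)) (Measure.pi fun _ : Fin n => gaussianReal 0 v) ∧
      ∫ x, (Uᵀ *ᵥ x) ⬝ᵥ (Uᵀ *ᵥ x) ∂(Measure.pi fun _ : Fin n => gaussianReal 0 v) =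
        Fintype.card ι * v := by
  have hlaw : ∀ k, HasLaw (fun x => (Uᵀ *ᵥ x) k) (gaussianReal 0 v)
      (Measure.pi fun _ : Fin n => gaussianReal 0 v) := fun k => by
    refine hasLaw_dotProduct_gaussian v (u := fun i => U i k) ?_
    have := congrFun (congrFun hU k) k
    simpa [Matrix.mul_apply, dotProduct] using this
  have hint : Integrable (fun x : ℝ => x ^ 2) (gaussianReal 0 v) :=
    (memLp_id_gaussianReal 2).integrable_sq
  have hval : ∫ x, x ^ 2 ∂(gaussianReal 0 v) = v := by
    have h1 := variance_id_gaussianReal (μ := 0) (v := v)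
    rw [variance_eq_integral aemeasurable_id] at h1
    simpa [integral_id_gaussianReal] using h1
  have hk : ∀ k, Integrable (fun x => (Uᵀ *ᵥ x) k ^ 2)
      (Measure.pi fun _ : Fin n => gaussianReal 0 v) := fun k => by
    have h1 := hint
    rw [← (hlaw k).map_eq] at h1
    exact h1.comp_aemeasurable (hlaw k).aemeasurable
  have hs : ∀ x : Fin n → ℝ, (Uᵀ *ᵥ x) ⬝ᵥ (Uᵀ *ᵥ x) = ∑ k, (Uᵀ *ᵥ x) k ^ 2 := fun x => by
    simp [dotProduct, sq]
  simp only [hs]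
  refine ⟨integrable_finsetSum _ fun k _ => hk k, ?_⟩
  rw [integral_finsetSum _ fun k _ => hk k]
  have : ∀ k, ∫ x, (Uᵀ *ᵥ x) k ^ 2 ∂(Measure.pi fun _ : Fin n => gaussianReal 0 v) = v :=
      fun k => by
    rw [← hval]
    exact (hlaw k).integral_comp (f := fun x : ℝ => x ^ 2) hint.aestronglyMeasurable
  simp [this]

/-- A sequence on varying probability spaces converges in distribution to `γ` if it is within
`r n → 0` of a variable `W` of law `γ`, except on an event `1 ≤ N` with `E N → 0`. -/
lemma tendstoInDistribution_of_abs_sub_le {Ω : ℕ → Type*} [∀ n, MeasurableSpace (Ω n)]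
    (P : ∀ n, Measure (Ω n)) [∀ n, IsProbabilityMeasure (P n)] {γ : Measure ℝ}
    [IsProbabilityMeasure γ] {T : ∀ n, Ω n → ℝ} {r p : ℕ → ℝ}
    (hT : ∀ n, AEMeasurable (T n) (P n)) (hr : Tendsto r atTop (𝓝 0)) (hp : Tendsto p atTop (𝓝 0))
    (h : ∀ᶠ n in atTop, ∃ W N : Ω n → ℝ, HasLaw W γ (P n) ∧ Integrable N (P n) ∧
      (∀ ω, 0 ≤ N ω) ∧ ∫ ω, N ω ∂(P n) ≤ p n ∧ ∀ ω, N ω < 1 → |T n ω - W ω| ≤ r n) :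
    TendstoInDistribution T atTop (id : ℝ → ℝ) P γ where
  forall_aemeasurable := hT
  aemeasurable_limit := aemeasurable_id
  tendsto := by
    refine tendsto_iff_forall_lipschitz_integral_tendsto.2 ?_
    rintro f ⟨C, hC⟩ ⟨K, hK⟩
    have hC0 : 0 ≤ C := (dist_nonneg).trans (hC 0 0)
    have hfm : Measurable f := hK.continuous.measurable
    have hfb : ∀ x, ‖f x‖ ≤ ‖f 0‖ + C := fun x => by
      have := hC x 0
      rw [dist_eq_norm] at this
      have h2 := norm_sub_norm_le (f x) (f 0)
      linarith
    simp only [ProbabilityMeasure.coe_mk, Measure.map_id]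
    rw [tendsto_iff_dist_tendsto_zero]
    have hlim : Tendsto (fun n => K * |r n| + C * p n) atTop (𝓝 0) := by
      have := (hr.abs.const_mul (K : ℝ)).add (hp.const_mul C)
      simpa using this
    refine squeeze_zero' (Eventually.of_forall fun _ => dist_nonneg) ?_ hlim
    filter_upwards [h] with n ⟨W, N, hW, hN, hN0, hNp, hTW⟩
    have hb : ∀ {g : Ω n → ℝ}, AEMeasurable g (P n) → Integrable (fun ω => f (g ω)) (P n) :=
      fun hg => Integrable.of_bound (hfm.comp_aemeasurable hg).aestronglyMeasurable _
        (ae_of_all _ fun ω => hfb _)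
    rw [integral_map (hT n) hfm.aestronglyMeasurable,
      ← hW.integral_comp (f := f) hfm.aestronglyMeasurable, dist_eq_norm]
    simp only [Function.comp_apply]
    rw [← integral_sub (hb (hT n)) (hb hW.aemeasurable)]
    have hbound : ∀ ω, ‖f (T n ω) - f (W ω)‖ ≤ K * |r n| + C * N ω := fun ω => by
      rw [← dist_eq_norm]
      rcases lt_or_ge (N ω) 1 with h1 | h1
      · have h2 := hK.dist_le_mul (T n ω) (W ω)
        have h3 : dist (T n ω) (W ω) ≤ |r n| := by
          rw [Real.dist_eq]
          exact (hTW ω h1).trans (le_abs_self _)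
        have h4 : (K : ℝ) * dist (T n ω) (W ω) ≤ K * |r n| := by gcongr
        have h5 := mul_nonneg hC0 (hN0 ω)
        linarith
      · have h2 := hC (T n ω) (W ω)
        have h3 : C * 1 ≤ C * N ω := by gcongr
        have h4 : 0 ≤ (K : ℝ) * |r n| := by positivity
        linarith
    calc ‖∫ ω, f (T n ω) - f (W ω) ∂(P n)‖ ≤ ∫ ω, K * |r n| + C * N ω ∂(P n) :=
          norm_integral_le_of_norm_le ((integrable_const _).add (hN.const_mul C))
            (ae_of_all _ hbound)
      _ = K * |r n| + C * ∫ ω, N ω ∂(P n) := by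
          rw [integral_add (integrable_const _) (hN.const_mul C), integral_const_mul C]
          simp
      _ ≤ _ := by gcongr

end Probability

/-! ### The active design -/

section Design

/-- With `R` the square root of `BᵀB`, the matrix `U = B R⁻¹` has orthonormal columns and carries
the errors to the scaled estimation error `R d` of least squares. -/
lemma exists_orthonormal_sqrt_mulVec {n : ℕ} {ι : Type*} [Fintype ι] [DecidableEq ι]
    (B : Matrix (Fin n) ι ℝ) (hB : (Bᵀ * B).PosDef) :
    ∃ U : Matrix (Fin n) ι ℝ, Uᵀ * U = 1 ∧ ∀ (d : ι → ℝ) (e : Fin n → ℝ),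
      (Bᵀ * B) *ᵥ d = Bᵀ *ᵥ e → CFC.sqrt (Bᵀ * B) *ᵥ d = Uᵀ *ᵥ e := by
  have h0 : 0 ≤ Bᵀ * B := Matrix.nonneg_iff_posSemidef.2 hB.posSemidef
  set R := CFC.sqrt (Bᵀ * B) with hR
  have hRR : R * R = Bᵀ * B := CFC.sqrt_mul_sqrt_self _ h0
  have hRT : Rᵀ = R := by
    have := (Matrix.nonneg_iff_posSemidef.1 (CFC.sqrt_nonneg (Bᵀ * B))).isHermitian.eq
    simpa using this
  have hRu : IsUnit R.det := by
    rw [← Matrix.isUnit_iff_isUnit_det]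
    exact (CFC.isUnit_sqrt_iff _ h0).2 hB.isUnit
  refine ⟨B * R⁻¹, ?_, fun d e hd => ?_⟩
  · rw [Matrix.transpose_mul, Matrix.transpose_nonsing_inv, hRT, Matrix.mul_assoc,
      ← Matrix.mul_assoc Bᵀ, ← hRR, Matrix.mul_assoc R, Matrix.mul_nonsing_inv _ hRu,
      Matrix.mul_one, Matrix.nonsing_inv_mul _ hRu]
  · rw [Matrix.transpose_mul, Matrix.transpose_nonsing_inv, hRT, ← mulVec_mulVec, ← hd, ← hRR,
      mulVec_mulVec, ← Matrix.mul_assoc, Matrix.nonsing_inv_mul _ hRu, Matrix.one_mul]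

lemma sqrt_mulVec_dotProduct_self {ι : Type*} [Fintype ι] [DecidableEq ι] {A : Matrix ι ι ℝ}
    (hA : A.PosSemidef) (z : ι → ℝ) :
    (CFC.sqrt A *ᵥ z) ⬝ᵥ (CFC.sqrt A *ᵥ z) = z ⬝ᵥ (A *ᵥ z) := by
  have h0 : 0 ≤ A := Matrix.nonneg_iff_posSemidef.2 hA
  have hRT : (CFC.sqrt A)ᵀ = CFC.sqrt A := by
    have := (Matrix.nonneg_iff_posSemidef.1 (CFC.sqrt_nonneg A)).isHermitian.eq
    simpa using this
  rw [dotProduct_mulVec, ← mulVec_transpose, hRT, mulVec_mulVec, CFC.sqrt_mul_sqrt_self _ h0,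
    dotProduct_comm]

variable {n G : ℕ} {m : Fin G → ℕ} {X : Matrix (Fin n) (Σ g, Fin (m g)) ℝ}
  {β : ∀ g, Fin (m g) → ℝ}

lemma linPred_eq_mulVec (X : Matrix (Fin n) (Σ g, Fin (m g)) ℝ) (b : ∀ g, Fin (m g) → ℝ) :
    linPred X b = X *ᵥ fun p => b p.1 p.2 := by
  ext i
  simp [linPred, mulVec, dotProduct, block, Fintype.sum_sigma, Finset.sum_apply]

lemma block_quadratic_ge {q : ℝ} (hq : ∀ b, q * (b ⬝ᵥ b) ≤ b ⬝ᵥ ((Xᵀ * X) *ᵥ b)) (g : Fin G)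
    (b : Fin (m g) → ℝ) :
    q * (b ⬝ᵥ b) ≤ b ⬝ᵥ (((block X g)ᵀ * block X g) *ᵥ b) := by
  set c : ∀ g, Fin (m g) → ℝ := Pi.single g b with hc
  have hcg : c g = b := by simp [hc]
  have hch : ∀ h, h ≠ g → c h = 0 := fun h hne => by simp [hc, hne]
  have h1 : linPred X c = block X g *ᵥ b := by
    rw [linPred, Finset.sum_eq_single g, hcg]
    · intro h _ hne
      rw [hch h hne, mulVec_zero]
    · simp
  have h2 : (fun p : Σ g, Fin (m g) => c p.1 p.2) ⬝ᵥ (fun p => c p.1 p.2) = b ⬝ᵥ b := by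
    rw [dotProduct, Fintype.sum_sigma, Finset.sum_eq_single g]
    · simp [hcg, dotProduct]
    · intro h _ hne
      simp [hch h hne]
    · simp
  have h3 := hq fun p => c p.1 p.2
  rw [h2, ← mulVec_mulVec, ← linPred_eq_mulVec, h1, dotProduct_mulVec, vecMul_transpose,
    ← linPred_eq_mulVec, h1] at h3
  rwa [← mulVec_mulVec, dotProduct_mulVec, vecMul_transpose]

lemma block_posDef {q : ℝ} (hq0 : 0 < q) (hq : ∀ b, q * (b ⬝ᵥ b) ≤ b ⬝ᵥ ((Xᵀ * X) *ᵥ b))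
    (g : Fin G) : ((block X g)ᵀ * block X g).PosDef := by
  refine Matrix.PosDef.of_dotProduct_mulVec_pos ?_ fun x hx => ?_
  · simpa using Matrix.isHermitian_conjTranspose_mul_self (block X g)
  · have h1 := block_quadratic_ge hq g x
    have h2 : 0 < x ⬝ᵥ x := by
      have := dotProduct_star_self_pos_iff.2 hx
      simpa using this
    have := mul_pos hq0 h2
    simp only [star_trivial]
    linarith

lemma activeGram_mulVec (hX : BlockOrthogonal X) (x : ActiveIdx β → ℝ) (k : ActiveIdx β) :
    (activeGram X β *ᵥ x) k =
      (((block X k.1.1)ᵀ * block X k.1.1) *ᵥ fun j => x ⟨k.1, j⟩) k.2 := by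
  have e : ∀ l : ActiveIdx β, activeGram X β k l =
      ((block X k.1.1)ᵀ * block X l.1.1) k.2 l.2 := fun l => by
    simp [activeGram, activeDesign, block, Matrix.mul_apply]
  rw [mulVec, dotProduct, Fintype.sum_sigma, Finset.sum_eq_single k.1]
  · simp only [e]
    rfl
  · intro h _ hne
    refine Finset.sum_eq_zero fun j _ => ?_
    rw [e, hX _ _ fun heq => hne (Subtype.ext heq.symm)]
    simp
  · simp

lemma dotProduct_activeGram (hX : BlockOrthogonal X) (x : ActiveIdx β → ℝ) :
    x ⬝ᵥ (activeGram X β *ᵥ x) = ∑ g : {g // g ∈ active β},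
      (fun j => x ⟨g, j⟩) ⬝ᵥ (((block X g.1)ᵀ * block X g.1) *ᵥ fun j => x ⟨g, j⟩) := by
  rw [dotProduct, Fintype.sum_sigma]
  simp only [activeGram_mulVec hX]
  rfl

lemma activeGram_posDef (hX : BlockOrthogonal X)
    (hQ : ∀ g, ((block X g)ᵀ * block X g).PosDef) : (activeGram X β).PosDef := by
  refine Matrix.PosDef.of_dotProduct_mulVec_pos ?_ fun x hx => ?_
  · simpa [activeGram] using Matrix.isHermitian_conjTranspose_mul_self (activeDesign X β)
  · rw [star_trivial, dotProduct_activeGram hX]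
    obtain ⟨⟨g, j⟩, hgj⟩ := Function.ne_iff.1 hx
    refine Finset.sum_pos' (fun h _ => ?_) ⟨g, Finset.mem_univ _, ?_⟩
    · simpa using (hQ h.1).posSemidef.dotProduct_mulVec_nonneg fun j => x ⟨h, j⟩
    · have : (fun j => x ⟨g, j⟩) ≠ 0 := fun h0 => hgj (congrFun h0 j)
      simpa using (hQ g.1).dotProduct_mulVec_pos this

lemma card_activeIdx_le {s : ℕ} (hm : ∀ g, m g ≤ s) (β : ∀ g, Fin (m g) → ℝ) :
    Fintype.card (ActiveIdx β) ≤ (active β).card * s := by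
  rw [Fintype.card_sigma]
  calc ∑ g : {g // g ∈ active β}, Fintype.card (Fin (m g.1))
      ≤ ∑ _g : {g // g ∈ active β}, s := Finset.sum_le_sum fun g _ => by simpa using hm g.1
    _ = _ := by simp

lemma quadratic_le_two_mul_add {k : ℕ} {Q : Matrix (Fin k) (Fin k) ℝ} (hQ : Q.PosSemidef)
    (x y : Fin k → ℝ) :
    (x - y) ⬝ᵥ (Q *ᵥ (x - y)) ≤ 2 * (x ⬝ᵥ (Q *ᵥ x)) + 2 * (y ⬝ᵥ (Q *ᵥ y)) := by
  have h := hQ.dotProduct_mulVec_nonneg (x + y)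
  simp only [star_trivial, mulVec_add, dotProduct_add, add_dotProduct] at h
  simp only [mulVec_sub, dotProduct_sub, sub_dotProduct]
  linarith

lemma block_transpose_mulVec_linPred (hX : BlockOrthogonal X) (b : ∀ g, Fin (m g) → ℝ)
    (g : Fin G) :
    (block X g)ᵀ *ᵥ linPred X b = ((block X g)ᵀ * block X g) *ᵥ b g := by
  rw [linPred, mulVec_sum, Finset.sum_eq_single g]
  · rw [mulVec_mulVec]
  · intro h _ hne
    rw [mulVec_mulVec, hX g h hne.symm, zero_mulVec]
  · simp

/-! ### The half-thresholding estimator against least squares -/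

/-- The statistic of the half-thresholding estimator differs from that of least squares, which is
the linear functional `(U α)ᵀ e` of the errors, by the shrinkage of the active groups. The signal
`S` of an active group exceeds `S₀` once the least squares error is small, and then a group
contributes a multiple of `κ² S ≤ K² / S₀`. -/
lemma exists_sq_activeStatistic_sub_le {a : ℝ} {L : ℝ → ℝ} (hprior : PolynomialTailPrior a L)
    (hX : BlockOrthogonal X) {q : ℝ} (hq0 : 0 < q)
    (hq : ∀ b, q * (b ⬝ᵥ b) ≤ b ⬝ᵥ ((Xᵀ * X) *ᵥ b)) {σ τ : ℝ} (hσ : 0 < σ) (hτ : 0 < τ)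
    {C₃ : ℝ} (hC₃ : 0 < C₃) (hmin : ∀ g ∈ active β, ∀ j, C₃ < |β g j|) {K S₀ : ℝ}
    (hS₀ : 0 < S₀) (hκ : ∀ g, ∀ S, S₀ ≤ S → meanKappa a L τ (m g) S ≤ K / S) :
    ∃ U : Matrix (Fin n) (ActiveIdx β) ℝ, Uᵀ * U = 1 ∧
      ∀ (α : EuclideanSpace ℝ (ActiveIdx β)) (e : Fin n → ℝ), ‖α‖ = 1 →
        (Uᵀ *ᵥ e) ⬝ᵥ (Uᵀ *ᵥ e) ≤ q * C₃ ^ 2 / 2 - σ ^ 2 * S₀ →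
        (activeStatistic X β α (htEstimator X σ a L τ (linPred X β + e)) -
          (U *ᵥ α.ofLp) ⬝ᵥ e) ^ 2 ≤ (active β).card * (4 * σ ^ 2 * K ^ 2 / S₀) := by
  have hQ := block_posDef hq0 hq
  have hA : (activeGram X β).PosDef := activeGram_posDef hX hQ
  obtain ⟨U, hU, hUR⟩ := exists_orthonormal_sqrt_mulVec (activeDesign X β) hA
  refine ⟨U, hU, fun α e hα hle => ?_⟩
  set y := linPred X β + e with hy
  set Q : ∀ g, Matrix (Fin (m g)) (Fin (m g)) ℝ := fun g => (block X g)ᵀ * block X g with hQdef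
  set w : ∀ g, Fin (m g) → ℝ := fun g => (Q g)⁻¹ *ᵥ ((block X g)ᵀ *ᵥ y) with hwdef
  have hw : ∀ g, Q g *ᵥ w g = (block X g)ᵀ *ᵥ y := fun g => by
    rw [hwdef, mulVec_mulVec, Matrix.mul_nonsing_inv _ (hQ g).det_pos.ne'.isUnit, one_mulVec]
  choose ρ hρ0 hρ hht using fun g => exists_htEstimator_eq hprior hX hQ hσ hτ y g (hw g)
  set d : ActiveIdx β → ℝ := fun k => w k.1.1 k.2 - β k.1.1 k.2 with hd
  set z : ActiveIdx β → ℝ := fun k => ρ k.1.1 * w k.1.1 k.2 with hz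
  have hnormal : activeGram X β *ᵥ d = (activeDesign X β)ᵀ *ᵥ e := by
    ext k
    have h1 : Q k.1.1 *ᵥ (w k.1.1 - β k.1.1) = (block X k.1.1)ᵀ *ᵥ e := by
      rw [mulVec_sub, hw, hy, mulVec_add, block_transpose_mulVec_linPred hX]
      exact add_sub_cancel_left _ _
    rw [activeGram_mulVec hX]
    exact congrFun h1 k.2
  have hRd := hUR d e hnormal
  have hstat : activeStatistic X β α (htEstimator X σ a L τ y) - (U *ᵥ α.ofLp) ⬝ᵥ e =
      -(α.ofLp ⬝ᵥ (CFC.sqrt (activeGram X β) *ᵥ z)) := by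
    have h1 : (fun k : ActiveIdx β => htEstimator X σ a L τ y k.1.1 k.2 - β k.1.1 k.2) =
        d - z := by
      ext k
      simp only [hht, Pi.smul_apply, smul_eq_mul, Pi.sub_apply, hd, hz]
      ring
    have h2 : (U *ᵥ α.ofLp) ⬝ᵥ e = α.ofLp ⬝ᵥ (Uᵀ *ᵥ e) := by
      rw [dotProduct_mulVec, vecMul_transpose]
    rw [activeStatistic, h1, mulVec_sub, dotProduct_sub, h2]
    change α.ofLp ⬝ᵥ (CFC.sqrt ((activeDesign X β)ᵀ * activeDesign X β) *ᵥ d) - _ - _ = _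
    rw [hRd]
    ring
  have hcs : (α.ofLp ⬝ᵥ (CFC.sqrt (activeGram X β) *ᵥ z)) ^ 2 ≤ z ⬝ᵥ (activeGram X β *ᵥ z) := by
    have h1 : ∑ k, α.ofLp k ^ 2 = 1 := by
      rw [← EuclideanSpace.real_norm_sq_eq, hα, one_pow]
    rw [← sqrt_mulVec_dotProduct_self hA.posSemidef]
    have h2 := Finset.sum_mul_sq_le_sq_mul_sq Finset.univ α.ofLp
      (CFC.sqrt (activeGram X β) *ᵥ z)
    rw [h1, one_mul] at h2
    calc _ ≤ _ := h2
      _ = _ := by simp [dotProduct, sq]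
  have hterm : ∀ g : {g // g ∈ active β},
      (fun j => z ⟨g, j⟩) ⬝ᵥ (Q g.1 *ᵥ fun j => z ⟨g, j⟩) ≤ 4 * σ ^ 2 * K ^ 2 / S₀ := by
    rintro ⟨g, hg⟩
    have hsemi := (hQ g).posSemidef
    have hzg : (fun j => z ⟨⟨g, hg⟩, j⟩) = ρ g • w g := rfl
    rw [hzg, mulVec_smul, dotProduct_smul, smul_dotProduct, smul_eq_mul, smul_eq_mul]
    have hρg := hρ g
    have hρg0 := hρ0 g
    set A := w g ⬝ᵥ (Q g *ᵥ w g) with hAdef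
    have herr : (w g - β g) ⬝ᵥ (Q g *ᵥ (w g - β g)) ≤ q * C₃ ^ 2 / 2 - σ ^ 2 * S₀ := by
      refine le_trans ?_ hle
      rw [← hRd]
      change _ ≤ (CFC.sqrt (activeGram X β) *ᵥ d) ⬝ᵥ (CFC.sqrt (activeGram X β) *ᵥ d)
      rw [sqrt_mulVec_dotProduct_self hA.posSemidef, dotProduct_activeGram hX]
      refine Finset.single_le_sum (f := fun g : {g // g ∈ active β} =>
        (fun j => d ⟨g, j⟩) ⬝ᵥ (((block X g.1)ᵀ * block X g.1) *ᵥ fun j => d ⟨g, j⟩))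
        (fun h _ => ?_) (Finset.mem_univ (⟨g, hg⟩ : {g // g ∈ active β}))
      simpa using (hQ h.1).posSemidef.dotProduct_mulVec_nonneg fun j => d ⟨h, j⟩
    have hsig : q * C₃ ^ 2 ≤ β g ⬝ᵥ (Q g *ᵥ β g) := by
      refine le_trans ?_ (block_quadratic_ge hq g (β g))
      gcongr
      have hne : β g ≠ 0 := by simpa [active] using hg
      obtain ⟨j, -⟩ := Function.ne_iff.1 hne
      calc C₃ ^ 2 ≤ |β g j| ^ 2 := by
            have := hmin g hg j
            gcongr
        _ = β g j * β g j := by rw [sq_abs, sq]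
        _ ≤ β g ⬝ᵥ β g := Finset.single_le_sum (f := fun j => β g j * β g j)
            (fun i _ => mul_self_nonneg _) (Finset.mem_univ j)
    have htwo := quadratic_le_two_mul_add hsemi (w g) (w g - β g)
    rw [sub_sub_cancel] at htwo
    have hAS : S₀ ≤ A / σ ^ 2 := by
      rw [le_div_iff₀ (by positivity)]
      linarith
    set S := A / σ ^ 2 with hS
    have hS0 : 0 < S := lt_of_lt_of_le hS₀ hAS
    have hAeq : A = σ ^ 2 * S := by rw [hS]; field_simp
    have hρK : ρ g ≤ 2 * (K / S) := hρg.trans (by linarith [hκ g S hAS])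
    calc ρ g * (ρ g * A) = ρ g ^ 2 * (σ ^ 2 * S) := by rw [hAeq]; ring
      _ ≤ (2 * (K / S)) ^ 2 * (σ ^ 2 * S) := by gcongr
      _ = 4 * σ ^ 2 * K ^ 2 / S := by field_simp; ring
      _ ≤ _ := by gcongr
  rw [hstat, neg_sq]
  refine hcs.trans ?_
  rw [dotProduct_activeGram hX]
  calc _ ≤ ∑ _g : {g // g ∈ active β}, 4 * σ ^ 2 * K ^ 2 / S₀ :=
        Finset.sum_le_sum fun g _ => hterm g
    _ = _ := by simp

end Design

/-! ### Rates -/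

/-- Since `log (1/τ) ≤ 4 τ ^ (-1/4)`, the assumption bounds `τ` below by a power of `n`. -/
lemma inv_sq_le_of_one_le {n G : ℕ} (hG : G ≤ n) {τ : ℝ} (hτ : 0 < τ)
    (h : 1 ≤ (G : ℝ) * √τ * Real.log (1 / τ)) :
    1 / τ ^ 2 ≤ (4 * n : ℝ) ^ 8 := by
  have hx : 0 < τ ^ (1 / 4 : ℝ) := by positivity
  set x := τ ^ (1 / 4 : ℝ) with hxdef
  have hx4 : x ^ 4 = τ := by
    rw [hxdef, ← Real.rpow_natCast, ← Real.rpow_mul hτ.le]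
    norm_num
  have hsqrt : √τ = x ^ 2 := by
    rw [← hx4, show x ^ 4 = (x ^ 2) ^ 2 by ring, Real.sqrt_sq (by positivity)]
  have hlog : Real.log (1 / τ) ≤ 4 * x⁻¹ := by
    have := Real.log_le_rpow_div (x := 1 / τ) (ε := 1 / 4) (by positivity) (by norm_num)
    rw [one_div τ, Real.inv_rpow hτ.le] at this
    rw [one_div τ]
    linarith
  have hGn : (G : ℝ) ≤ n := by exact_mod_cast hG
  have hlog0 : 0 ≤ Real.log (1 / τ) := by
    by_contra! hneg
    have := mul_nonpos_of_nonneg_of_nonpos (by positivity : 0 ≤ (G : ℝ) * √τ) hneg.le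
    linarith
  have h1 : 1 ≤ 4 * n * x := by
    calc (1 : ℝ) ≤ (G : ℝ) * √τ * Real.log (1 / τ) := h
      _ ≤ (n : ℝ) * x ^ 2 * (4 * x⁻¹) := by rw [hsqrt]; gcongr
      _ = 4 * n * x := by field_simp
  rw [← hx4, div_le_iff₀ (by positivity)]
  calc (1 : ℝ) ≤ (4 * n * x) ^ 8 := one_le_pow₀ h1
    _ = _ := by ring

/-- Here `1 ≤ G n * r n ≤ n * r n` for large `n`, so that `A n / n ≤ A n * r n`. For `A n = 0` the
value `1 / 0 = 0` does no harm. -/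
lemma tendsto_card_div {A G : ℕ → ℕ} (hG : ∀ᶠ n in atTop, G n ≤ n) {r : ℕ → ℝ}
    (hr : Tendsto (fun n => (G n : ℝ) * r n) atTop atTop)
    (hA : r =o[atTop] fun n => 1 / (A n : ℝ)) :
    Tendsto (fun n : ℕ => (A n : ℝ) / n) atTop (𝓝 0) := by
  have h1 : Tendsto (fun n => r n * A n) atTop (𝓝 0) := by
    have := hA.tendsto_div_nhds_zero
    simpa [div_div_eq_mul_div] using this
  refine squeeze_zero' (Eventually.of_forall fun _ => by positivity) ?_ h1
  filter_upwards [hG, hr.eventually_ge_atTop 1, eventually_gt_atTop 0] with n h2 h3 h4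
  have hn : (0 : ℝ) < n := by exact_mod_cast h4
  have hGn : (G n : ℝ) ≤ n := by exact_mod_cast h2
  have hr0 : 0 < r n := by
    by_contra! h
    have := mul_nonpos_of_nonneg_of_nonpos (Nat.cast_nonneg (α := ℝ) (G n)) h
    linarith
  rw [div_le_iff₀ hn]
  have h5 : 1 ≤ r n * n := h3.trans (by rw [mul_comm]; gcongr)
  calc (A n : ℝ) = A n * 1 := (mul_one _).symm
    _ ≤ A n * (r n * n) := by gcongr
    _ = _ := by ring

lemma quadratic_ge_of_spectrum {n : ℕ} {ι : Type*} [Fintype ι] [DecidableEq ι]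
    (X : Matrix (Fin n) ι ℝ) (hn : 0 < n) {c : ℝ}
    (h : ∀ e ∈ spectrum ℝ ((1 / (n : ℝ)) • (Xᵀ * X)), c ≤ e) (b : ι → ℝ) :
    n * c * (b ⬝ᵥ b) ≤ b ⬝ᵥ ((Xᵀ * X) *ᵥ b) := by
  have hn' : (0 : ℝ) < n := by exact_mod_cast hn
  have hherm : IsSelfAdjoint ((1 / (n : ℝ)) • (Xᵀ * X)) := by
    have : (Xᵀ * X).IsHermitian := by
      simpa using Matrix.isHermitian_conjTranspose_mul_self X
    exact (IsSelfAdjoint.all _).smul this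
  have h1 : algebraMap ℝ (Matrix ι ι ℝ) c ≤ (1 / (n : ℝ)) • (Xᵀ * X) :=
    algebraMap_le_of_le_spectrum h hherm
  have h2 := (Matrix.le_iff.1 h1).dotProduct_mulVec_nonneg b
  simp only [star_trivial, sub_mulVec, Algebra.algebraMap_eq_smul_one, smul_mulVec, one_mulVec,
    dotProduct_sub, dotProduct_smul, smul_eq_mul, sub_nonneg] at h2
  rw [one_div, le_inv_mul_iff₀ hn'] at h2
  linarith

end GroupHT

theorem theorem2
    -- the prior on the local shrinkage parameters, and the error variance
    (a : ℝ) (L : ℝ → ℝ) (hprior : PolynomialTailPrior a L) (htail : TailAssumption a L)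
    (σ : ℝ) (hσ : 0 < σ)
    -- the sequence of designs: `G n` groups, of sizes `m n g`
    (G : ℕ → ℕ) (m : ∀ n, Fin (G n) → ℕ)
    (X : ∀ n, Matrix (Fin n) (Σ g, Fin (m n g)) ℝ)
    (hG : ∀ᶠ n in atTop, G n ≤ n)
    (s : ℕ) (hm : ∀ n g, m n g ≤ s)
    (horth : ∀ᶠ n in atTop, BlockOrthogonal (X n))
    -- the true coefficients and the errors
    (β₀ : ∀ n, ∀ g, Fin (m n g) → ℝ)
    {Ω : ℕ → Type*} [∀ n, MeasurableSpace (Ω n)] (P : ∀ n, Measure (Ω n))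
    [∀ n, IsProbabilityMeasure (P n)]
    (ε : ∀ n, Ω n → Fin n → ℝ)
    (hε : ∀ n, HasLaw (ε n) (Measure.pi fun _ => gaussianReal 0 (σ ^ 2).toNNReal) (P n))
    -- eigenvalues of `XᵀX / n`
    (C₁ C₂ : ℝ) (hC₁ : 0 < C₁) (hC₁₂ : C₁ ≤ C₂)
    (heig : ∀ᶠ n : ℕ in atTop,
      ∀ e ∈ spectrum ℝ ((1 / (n : ℝ)) • ((X n)ᵀ * X n)), C₁ ≤ e ∧ e ≤ C₂)
    -- active coefficients
    (C₃ : ℝ) (hC₃ : 0 < C₃)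
    (hmin : ∀ᶠ n in atTop, ∀ g ∈ active (β₀ n), ∀ j, C₃ < |β₀ n g j|)
    -- the global shrinkage parameter
    (τ : ℕ → ℝ) (hτ : ∀ n, 0 < τ n) (hτ0 : Tendsto τ atTop (𝓝 0))
    (hτG : Tendsto (fun n => (G n : ℝ) * √(τ n) * Real.log (1 / τ n)) atTop atTop)
    (hτA : (fun n => √(τ n) * Real.log (1 / τ n))
      =o[atTop] fun n => 1 / ((active (β₀ n)).card : ℝ))
    -- the unit vectors
    (α : ∀ n, EuclideanSpace ℝ (ActiveIdx (β₀ n))) (hα : ∀ᶠ n in atTop, ‖α n‖ = 1) :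
    TendstoInDistribution
      (fun n ω => activeStatistic (X n) (β₀ n) (α n)
        (htEstimator (X n) σ a L (τ n) (linPred (X n) (β₀ n) + ε n ω)))
      atTop (id : ℝ → ℝ) P (gaussianReal 0 (σ ^ 2).toNNReal) := by

  -- off a rare event the signal of every active group is at least `n * c`
  set c : ℝ := C₁ * C₃ ^ 2 / (4 * σ ^ 2) with hc
  have hc0 : 0 < c := by positivity
  choose K τ₀ hK0 hτ₀ hK using fun k : ℕ =>
    exists_meanKappa_le hprior htail k (D := (4 / c) ^ 8) (by positivity)
  -- the group sizes are bounded, so that one constant serves all groups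
  set K' : ℝ := ∑ k ∈ Finset.range (s + 1), K k with hK'
  have hKK' : ∀ k ≤ s, K k ≤ K' := fun k hk =>
    Finset.single_le_sum (fun i _ => (hK0 i).le) (Finset.mem_range.2 (by omega))
  have hτsmall : ∀ᶠ n in atTop, ∀ k ∈ Finset.range (s + 1), τ n ≤ τ₀ k :=
    (Finset.range (s + 1)).eventually_all.2 fun k _ => hτ0.eventually_le_const (hτ₀ k)
  have hcard : Tendsto (fun n : ℕ => ((active (β₀ n)).card : ℝ) / n) atTop (𝓝 0) :=
    tendsto_card_div hG (by simpa only [mul_assoc] using hτG) hτA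
  have hbig : ∀ᶠ n : ℕ in atTop, 1 ≤ (n : ℝ) * c :=
    (tendsto_natCast_atTop_atTop.atTop_mul_const hc0).eventually_ge_atTop 1
  refine tendstoInDistribution_of_abs_sub_le P
    (r := fun n => √((active (β₀ n)).card / n * (4 * σ ^ 2 * K' ^ 2 / c)))
    (p := fun n => (active (β₀ n)).card / n * (4 * s * σ ^ 2 / (C₁ * C₃ ^ 2)))
    (fun n => ?_) ?_ ?_ ?_
  · have hmeas := measurable_activeStatistic_htEstimator hprior (X n) σ (τ n) (β₀ n) (α n)
    exact hmeas.comp_aemeasurable ((hε n).aemeasurable.const_add _)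
  · have := (hcard.mul_const (4 * σ ^ 2 * K' ^ 2 / c)).sqrt
    simpa using this
  · simpa using hcard.mul_const (4 * s * σ ^ 2 / (C₁ * C₃ ^ 2))
  filter_upwards [hG, horth, heig, hmin, hα, hτsmall, hbig, eventually_gt_atTop 0,
    hτG.eventually_ge_atTop 1] with n hGn hX heign hminn hαn hτn hn1 hn hτGn
  have hn' : (0 : ℝ) < n := by exact_mod_cast hn
  have hq := quadratic_ge_of_spectrum (X n) hn fun e he => (heign e he).1
  have hS₀ : 0 < n * c := by positivity
  have hκ : ∀ g, ∀ S, n * c ≤ S → meanKappa a L (τ n) (m n g) S ≤ K' / S := fun g S hS => by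
    have hS0 : 0 < S := hS₀.trans_le hS
    refine (hK (m n g) (τ n) S (hτ n) (hτn _ (Finset.mem_range.2 (Nat.lt_succ_of_le (hm n g))))
      (hn1.trans hS) ?_).trans ?_
    · calc 1 / τ n ^ 2 ≤ (4 * n : ℝ) ^ 8 := inv_sq_le_of_one_le hGn (hτ n) hτGn
        _ ≤ (4 * (S / c)) ^ 8 := by
            gcongr
            rwa [le_div_iff₀ hc0]
        _ = _ := by ring
    · have := hKK' _ (hm n g)
      gcongr
  obtain ⟨U, hU, happrox⟩ := exists_sq_activeStatistic_sub_le hprior hX (by positivity) hq hσ (hτ n)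
    hC₃ hminn hS₀ hκ
  have hunit : (U *ᵥ (α n).ofLp) ⬝ᵥ (U *ᵥ (α n).ofLp) = 1 := by
    rw [dotProduct_mulVec, vecMul_mulVec, hU, vecMul_one, ← one_pow 2, ← hαn,
      EuclideanSpace.real_norm_sq_eq]
    simp [dotProduct, sq]
  obtain ⟨hint, hval⟩ := integrable_and_integral_sq_transpose_mulVec (σ ^ 2).toNNReal hU
  -- the rare event is that the squared least squares error `‖Uᵀ ε‖²` reaches `t = σ² n c`
  set t : ℝ := n * C₁ * C₃ ^ 2 / 4 with ht
  have ht0 : 0 < t := by positivity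
  refine ⟨fun ω => (U *ᵥ (α n).ofLp) ⬝ᵥ ε n ω, fun ω => (Uᵀ *ᵥ ε n ω) ⬝ᵥ (Uᵀ *ᵥ ε n ω) / t,
    (hasLaw_dotProduct_gaussian _ hunit).comp (hε n), ?_, fun ω => ?_, ?_, fun ω hω => ?_⟩
  · have h1 := hint
    rw [← (hε n).map_eq] at h1
    exact (h1.comp_aemeasurable (hε n).aemeasurable).div_const t
  · exact div_nonneg (by simpa using dotProduct_star_self_nonneg (Uᵀ *ᵥ ε n ω)) ht0.le
  · have h1 := (hε n).integral_comp (f := fun x => (Uᵀ *ᵥ x) ⬝ᵥ (Uᵀ *ᵥ x)) hint.aestronglyMeasurable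
    simp only [Function.comp_def] at h1
    rw [integral_div, h1, hval, Real.coe_toNNReal _ (sq_nonneg σ), ht]
    have h2 : (Fintype.card (ActiveIdx (β₀ n)) : ℝ) ≤ (active (β₀ n)).card * s := by
      exact_mod_cast card_activeIdx_le (hm n) (β₀ n)
    calc (Fintype.card (ActiveIdx (β₀ n)) : ℝ) * σ ^ 2 / (n * C₁ * C₃ ^ 2 / 4)
        ≤ (active (β₀ n)).card * s * σ ^ 2 / (n * C₁ * C₃ ^ 2 / 4) := by gcongr
      _ = _ := by field_simp
  · refine Real.abs_le_sqrt ?_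
    rw [div_lt_one ht0] at hω
    refine (happrox (α n) (ε n ω) hαn ?_).trans_eq ?_
    · have : σ ^ 2 * (n * c) = t := by rw [hc, ht]; field_simp
      rw [this, ht]
      rw [ht] at hω
      linarith
    · field_simp
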